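/- Notation. $M^T$ and $M^*$ denote the transpose and the conjugate transpose of a complex matrix, $M^{-T}=(M^{-1})^T$, and $\Pi^+=\{s\in\mathbb C:\operatorname{Re}s>0\}$. A rational matrix $W$ is a *Schur function* if it is holomorphic on $\Pi^+$ and $W(s)W(s)^*\le I$ for all $s\in\Pi^+$. A square rational matrix is *unitary on the imaginary axis* if it has no pole on $i\mathbb R$ and $W(i\omega)W(i\omega)^*=I$ for all $\omega\in\mathbb R$; it is *inner* if it is a Schur function that is unitary on the imaginary axis. A *realization* of a proper rational matrix $W$ is a quadruple $(A,B,C,D)$ of complex matrices with $W(s)=C(sI-A)^{-1}B+D$; the smallest possible size of $A$ is the *McMillan degree* $\deg W$, and a realization attaining it is *minimal*. Setting. Let $S$ be a symmetric ($S=S^T$) rational $p\times p$ Schur function that is finite and strictly contractive at infinity, $\|S(\infty)\|<1$. Let $(A,B,C,D)$ be a minimal realization of $S$, of size $n=\deg S$, that is symmetric: $A=A^T$, $B^T=C$, $D=D^T$. Put $$\hat A=A+BD^*(I-DD^*)^{-1}C,\qquad \hat B=B(I-D^*D)^{-1/2},\qquad \hat C=(I-DD^*)^{-1/2}C,$$ $$H=\begin{pmatrix}-\hat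 A^*&-\hat C^*\hat C\\ \hat B\hat B^*&\hat A\end{pmatrix},$$ and let $P$ be a Hermitian solution of the Riccati equation $$P\hat C^*\hat C P+\hat A P+P\hat A^*+\hat B\hat B^*=0 .$$ Such a $P$ is invertible. Let $\mathcal S_P$ be the $2p\times2p$ rational matrix $$\mathcal S_P(s)=\begin{pmatrix}S_{11}&S_{12}\\S_{21}&S\end{pmatrix}=\begin{pmatrix}C_1\\C\end{pmatrix}(sI-A)^{-1}\begin{pmatrix}B_1&B\end{pmatrix}+\begin{pmatrix}-D^*&(I-D^*D)^{1/2}\\(I-DD^*)^{1/2}&D\end{pmatrix},$$ $$B_1=-(PC^*+BD^*)(I-DD^*)^{-1/2},\qquad C_1=-(I-D^*D)^{-1/2}(B^*P^{-1}+D^*C).$$ **Proposition.** $S_{21}$ is invertible as a rational matrix, so $Q=S_{21}^{-1}S_{12}^T$ is well defined, and $Q$ is unitary on the imaginary axis. The matrix $$\Sigma_P=\mathcal S_P\begin{pmatrix}Q&0\\0&I_p\end{pmatrix}=\begin{pmatrix}S_{11}S_{21}^{-1}S_{12}^T&S_{12}\\S_{12}^T&S\end{pmatrix}$$ is a symmetric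 extension of $S$ that is unitary on the imaginary axis. The function $Q$ is proper with $\deg Q=\operatorname{rank}(P^{-T}-P)$, and $Q$ is inner if and only if $P^{-T}-P$ is positive semidefinite. In this case $\Sigma_P$ is inner and $\deg\Sigma_P=\deg S+\deg Q$. Moreover, in every case $\deg Q\ge\kappa$, where $\kappa$ is the number of distinct eigenvalues of $H$ in $\Pi^+$ of odd algebraic multiplicity. -/

import Mathlib

open scoped Matrix ComplexOrder MatrixOrder

namespace SymmetricDarlington

noncomputable section

/-- Matrices whose entries are rational functions of one complex variable `s`. -/
abbrev RatMatrix (ι κ : Type*) := Matrix ι κ (RatFunc ℂ)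

/-- `W` has no pole at `z`: the reduced denominator of each entry does not vanish at `z`. -/
def RegularAt {ι κ : Type*} (W : RatMatrix ι κ) (z : ℂ) : Prop :=
  ∀ i j, (W i j).denom.eval z ≠ 0

/-- The value `W(z)`; only meaningful when `W` has no pole at `z`. -/
def evalAt {ι κ : Type*} (W : RatMatrix ι κ) (z : ℂ) : Matrix ι κ ℂ :=
  W.map (RatFunc.eval (RingHom.id ℂ) z)

/-- A rational Schur function: holomorphic on the open right half-plane, and
`W(s) W(s)^* ≤ I` there. -/
def IsSchur {ι κ : Type*} [DecidableEq ι] [Fintype κ] (W : RatMatrix ι κ) : Prop :=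
  ∀ z : ℂ, 0 < z.re → RegularAt W z ∧ (1 - evalAt W z * (evalAt W z)ᴴ).PosSemidef

/-- A square rational matrix that is unitary on the imaginary axis: it has no pole there and
`W(iω) W(iω)^* = I` for every real `ω`. -/
def IsUnitaryOnAxis {ι : Type*} [Fintype ι] [DecidableEq ι] (W : RatMatrix ι ι) : Prop :=
  ∀ ω : ℝ, RegularAt W (ω * Complex.I) ∧
    evalAt W (ω * Complex.I) * (evalAt W (ω * Complex.I))ᴴ = 1

/-- An inner (lossless) rational matrix: a square Schur function that is unitary on the
imaginary axis. -/
def IsInner {ι : Type*} [Fintype ι] [DecidableEq ι] (W : RatMatrix ι ι) : Prop :=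
  IsSchur W ∧ IsUnitaryOnAxis W

/-- `W(∞) = L`. -/
def HasValueAtInfinity {ι κ : Type*} (W : RatMatrix ι κ) (L : Matrix ι κ ℂ) : Prop :=
  ∀ i j, Filter.Tendsto (fun z : ℂ => evalAt W z i j) (Filter.cocompact ℂ) (nhds (L i j))

/-- `W` is finite at infinity and `‖W(∞)‖ < 1` in the spectral norm,
that is, `I - W(∞) W(∞)^*` is positive definite. -/
def StrictlyContractiveAtInfinity {ι κ : Type*} [DecidableEq ι] [Fintype κ]
    (W : RatMatrix ι κ) : Prop :=
  ∃ L : Matrix ι κ ℂ, HasValueAtInfinity W L ∧ (1 - L * Lᴴ).PosDef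

/-- A constant matrix, viewed as a rational matrix. -/
def const {ι κ : Type*} (M : Matrix ι κ ℂ) : RatMatrix ι κ := M.map RatFunc.C

/-- The transfer function `C (s I - A)⁻¹ B + D`. -/
def transfer {n ι κ : Type*} [Fintype n] [DecidableEq n]
    (A : Matrix n n ℂ) (B : Matrix n κ ℂ) (C : Matrix ι n ℂ) (D : Matrix ι κ ℂ) :
    RatMatrix ι κ :=
  const C * (Matrix.scalar n RatFunc.X - const A)⁻¹ * const B + const D

/-- `W` has a realization of state dimension `n`. -/
def HasRealizationOfSize {ι κ : Type*} (W : RatMatrix ι κ) (n : ℕ) : Prop :=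
  ∃ (A : Matrix (Fin n) (Fin n) ℂ) (B : Matrix (Fin n) κ ℂ) (C : Matrix ι (Fin n) ℂ)
    (D : Matrix ι κ ℂ), W = transfer A B C D

/-- The McMillan degree of a proper rational matrix: the smallest state dimension of a
realization. It is `⊤` exactly when `W` has no realization, i.e. is not proper, so an equation
`mcMillanDegree W = d` with `d` a natural number includes the assertion that `W` is proper. -/
def mcMillanDegree {ι κ : Type*} (W : RatMatrix ι κ) : ℕ∞ :=
  ⨅ (n : ℕ) (_ : HasRealizationOfSize W n), (n : ℕ∞)

section Riccati

variable {p n : ℕ}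

/-- The positive semidefinite square root `(I - D D^*)^{1/2}`. -/
def D21 (D : Matrix (Fin p) (Fin p) ℂ) : Matrix (Fin p) (Fin p) ℂ :=
  CFC.sqrt (1 - D * Dᴴ)

/-- The positive semidefinite square root `(I - D^* D)^{1/2}`. -/
def D12 (D : Matrix (Fin p) (Fin p) ℂ) : Matrix (Fin p) (Fin p) ℂ :=
  CFC.sqrt (1 - Dᴴ * D)

/-- `Â = A + B D^* (I - D D^*)⁻¹ C`. -/
def hatA (A : Matrix (Fin n) (Fin n) ℂ) (B : Matrix (Fin n) (Fin p) ℂ)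
    (C : Matrix (Fin p) (Fin n) ℂ) (D : Matrix (Fin p) (Fin p) ℂ) : Matrix (Fin n) (Fin n) ℂ :=
  A + B * Dᴴ * (1 - D * Dᴴ)⁻¹ * C

/-- `B̂ = B (I - D^* D)^{-1/2}`. -/
def hatB (B : Matrix (Fin n) (Fin p) ℂ) (D : Matrix (Fin p) (Fin p) ℂ) :
    Matrix (Fin n) (Fin p) ℂ :=
  B * (D12 D)⁻¹

/-- `Ĉ = (I - D D^*)^{-1/2} C`. -/
def hatC (C : Matrix (Fin p) (Fin n) ℂ) (D : Matrix (Fin p) (Fin p) ℂ) :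
    Matrix (Fin p) (Fin n) ℂ :=
  (D21 D)⁻¹ * C

/-- The Hamiltonian matrix `H = [[-Â^*, -Ĉ^* Ĉ], [B̂ B̂^*, Â]]`. -/
def hamiltonian (A : Matrix (Fin n) (Fin n) ℂ) (B : Matrix (Fin n) (Fin p) ℂ)
    (C : Matrix (Fin p) (Fin n) ℂ) (D : Matrix (Fin p) (Fin p) ℂ) :
    Matrix (Fin n ⊕ Fin n) (Fin n ⊕ Fin n) ℂ :=
  Matrix.fromBlocks (-(hatA A B C D)ᴴ) (-((hatC C D)ᴴ * hatC C D))
    (hatB B D * (hatB B D)ᴴ) (hatA A B C D)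

/-- The Riccati map `P ↦ P Ĉ^* Ĉ P + Â P + P Â^* + B̂ B̂^*`. -/
def riccati (A : Matrix (Fin n) (Fin n) ℂ) (B : Matrix (Fin n) (Fin p) ℂ)
    (C : Matrix (Fin p) (Fin n) ℂ) (D : Matrix (Fin p) (Fin p) ℂ)
    (P : Matrix (Fin n) (Fin n) ℂ) : Matrix (Fin n) (Fin n) ℂ :=
  P * ((hatC C D)ᴴ * hatC C D) * P + hatA A B C D * P + P * (hatA A B C D)ᴴ
    + hatB B D * (hatB B D)ᴴ

/-- `B₁ = -(P C^* + B D^*) (I - D D^*)^{-1/2}`. -/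
def B1 (B : Matrix (Fin n) (Fin p) ℂ) (C : Matrix (Fin p) (Fin n) ℂ)
    (D : Matrix (Fin p) (Fin p) ℂ) (P : Matrix (Fin n) (Fin n) ℂ) : Matrix (Fin n) (Fin p) ℂ :=
  -((P * Cᴴ + B * Dᴴ) * (D21 D)⁻¹)

/-- `C₁ = -(I - D^* D)^{-1/2} (B^* P⁻¹ + D^* C)`. -/
def C1 (B : Matrix (Fin n) (Fin p) ℂ) (C : Matrix (Fin p) (Fin n) ℂ)
    (D : Matrix (Fin p) (Fin p) ℂ) (P : Matrix (Fin n) (Fin n) ℂ) : Matrix (Fin p) (Fin n) ℂ :=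
  -((D12 D)⁻¹ * (Bᴴ * P⁻¹ + Dᴴ * C))

/-- The extension `𝒮_P` of `S`, with dynamics matrix `A`, input matrix `[B₁ B]`, output matrix
`[C₁; C]` and value `[[-D^*, D₁₂], [D₂₁, D]]` at infinity. -/
def extension (A : Matrix (Fin n) (Fin n) ℂ) (B : Matrix (Fin n) (Fin p) ℂ)
    (C : Matrix (Fin p) (Fin n) ℂ) (D : Matrix (Fin p) (Fin p) ℂ)
    (P : Matrix (Fin n) (Fin n) ℂ) : RatMatrix (Fin p ⊕ Fin p) (Fin p ⊕ Fin p) :=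
  transfer A (Matrix.fromCols (B1 B C D P) B) (Matrix.fromRows (C1 B C D P) C)
    (Matrix.fromBlocks (-Dᴴ) (D12 D) (D21 D) D)

/-- The number of distinct eigenvalues of `M` in the open right half-plane whose algebraic
multiplicity is odd. -/
def oddEigenvalueCount {m : Type*} [Fintype m] [DecidableEq m] (M : Matrix m m ℂ) : ℕ :=
  Set.ncard {z : ℂ | 0 < z.re ∧ Odd (M.charpoly.rootMultiplicity z)}

end Riccati

end

end SymmetricDarlington

/-!
The state space equations behind the statement are all instances of one notion. A realization
`(A, B, C, D)` is *lossless* with respect to a Hermitian matrix `P` (`IsLossless`) if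
`A P + P Aᴴ + B Bᴴ = 0`, `B Dᴴ + P Cᴴ = 0` and `D Dᴴ = I`. Its transfer function satisfies the
energy balance
`I - W(s) W(s)ᴴ = (s + s̄) C (s I - A)⁻¹ P (s I - A)⁻ᴴ Cᴴ`
(`IsLossless.one_sub_evalAt_mul`). Hence `W` is unitary on the imaginary axis, and it is a Schur
function if `P` is positive semidefinite; poles are excluded because a rational function that stays
bounded along points tending to `z` has no pole at `z`. Series connections of lossless realizations
are lossless.

The Riccati equation says exactly that the extension is lossless with respect to `P`
(`isLossless_extension`). Since `S₂₁` and `S₁₂ᵀ` share `A`, `C` and the value at infinity, their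
quotient is `Q = I - Ĉ (s I - Z)⁻¹ X Ĉᴴ` with `Z = Â + P ĈᴴĈ` and `X = P⁻ᵀ - P`
(`quotient_eq_transfer`). By the symmetry of the realization `P⁻ᵀ` also solves the Riccati equation,
and subtracting the two equations shows that this realization of `Q` is lossless with respect to
`X`. In an orthonormal eigenbasis of `X` the matrix `Z` is block triangular, and restricting to the
range of `X` gives a controllable and observable realization with `A`-matrix `Z₁`, lossless with
respect to an invertible diagonal matrix `Y` of size `rank X` (`exists_minimal_lossless`). The
remaining assertions follow from it.

* The degree of `Q` is `rank X`, because controllable and observable realizations are minimal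
  (`mcMillanDegree_transfer`).
* If `Q` is inner, it has no poles in the right half-plane, so `Z₁` is stable, and the Lyapunov
  equation forces `Y`, hence `X`, to be positive semidefinite (`IsStable.posSemidef_of_lyapunov`).
* In that case the series connection of the extension with `diag(Q, I)` is stable and lossless with
  respect to `diag(P, Y)`, which is positive definite, so it is minimal and no degree is lost.
* The symmetry of `Σ_P` is automatic for a unitary completion `[[E, W], [Wᵀ, S]]` of a symmetric `S`
  (`transpose_eq_of_isUnitaryOnAxis`).
* The characteristic polynomial of `H` is the product of those of `Z` and of `Z + X ĈᴴĈ`. These two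
  matrices agree modulo the range of `X`, and on the range they are `Z₁` and a matrix similar to
  `-Z₁ᴴ`. So an eigenvalue of `H` of odd multiplicity is an eigenvalue of `Z₁` or of `-Z₁ᴴ`, which
  bounds the number of those in the right half-plane by the size of `Z₁`
  (`oddEigenvalueCount_le`).
-/

namespace SymmetricDarlington

noncomputable section

open Filter Topology

/-! ### Rational functions and their values -/

/-- The rational function `f` has no pole at `z`. -/
def IsRegularAt (f : RatFunc ℂ) (z : ℂ) : Prop := f.denom.eval z ≠ 0

/-- The value of a rational function, meaningful at regular points. -/
abbrev ev (z : ℂ) (f : RatFunc ℂ) : ℂ := RatFunc.eval (RingHom.id ℂ) z f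

section RationalFunctions

variable {f g : RatFunc ℂ} {z : ℂ}

lemma ev_eq_div (z : ℂ) (f : RatFunc ℂ) : ev z f = f.num.eval z / f.denom.eval z := rfl

/-- A fraction `a / b` is regular wherever `b` does not vanish, reduced or not. -/
lemma isRegularAt_of_mul_eq {a b : Polynomial ℂ} (hb : b.eval z ≠ 0)
    (h : f * algebraMap _ (RatFunc ℂ) b = algebraMap _ _ a) : IsRegularAt f z := by
  have hb0 : b ≠ 0 := by rintro rfl; simp at hb
  have hb1 : algebraMap _ (RatFunc ℂ) b ≠ 0 := RatFunc.algebraMap_ne_zero hb0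
  have hf : f = algebraMap _ _ a / algebraMap _ _ b := by rw [← h, mul_div_cancel_right₀ _ hb1]
  intro h0
  have hd := RatFunc.denom_div_dvd a b
  rw [← hf] at hd
  obtain ⟨c, hc⟩ := hd
  apply hb
  rw [hc, Polynomial.eval_mul, h0, zero_mul]

lemma IsRegularAt.add (hf : IsRegularAt f z) (hg : IsRegularAt g z) : IsRegularAt (f + g) z := by
  intro h
  obtain ⟨c, hc⟩ := RatFunc.denom_add_dvd f g
  have := congrArg (Polynomial.eval z) hc
  rw [Polynomial.eval_mul, Polynomial.eval_mul, h, zero_mul] at this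
  exact mul_ne_zero hf hg this

lemma IsRegularAt.mul (hf : IsRegularAt f z) (hg : IsRegularAt g z) : IsRegularAt (f * g) z := by
  intro h
  obtain ⟨c, hc⟩ := RatFunc.denom_mul_dvd f g
  have := congrArg (Polynomial.eval z) hc
  rw [Polynomial.eval_mul, Polynomial.eval_mul, h, zero_mul] at this
  exact mul_ne_zero hf hg this

lemma isRegularAt_C (c z : ℂ) : IsRegularAt (RatFunc.C c) z := by simp [IsRegularAt]

lemma isRegularAt_X (z : ℂ) : IsRegularAt RatFunc.X z := by simp [IsRegularAt]

lemma isRegularAt_zero (z : ℂ) : IsRegularAt 0 z := by simp [IsRegularAt]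

lemma IsRegularAt.ev_add (hf : IsRegularAt f z) (hg : IsRegularAt g z) :
    ev z (f + g) = ev z f + ev z g := RatFunc.eval_add _ _ hf hg

lemma IsRegularAt.ev_mul (hf : IsRegularAt f z) (hg : IsRegularAt g z) :
    ev z (f * g) = ev z f * ev z g := RatFunc.eval_mul _ _ hf hg

lemma isRegularAt_sum {α : Type*} (s : Finset α) (F : α → RatFunc ℂ)
    (h : ∀ a ∈ s, IsRegularAt (F a) z) :
    IsRegularAt (∑ a ∈ s, F a) z ∧ ev z (∑ a ∈ s, F a) = ∑ a ∈ s, ev z (F a) := by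
  classical
  induction s using Finset.induction_on with
  | empty => simp [isRegularAt_zero]
  | insert a s ha ih =>
    obtain ⟨h1, h2⟩ := ih fun b hb => h b (Finset.mem_insert_of_mem hb)
    have h3 := h a (Finset.mem_insert_self a s)
    rw [Finset.sum_insert ha, Finset.sum_insert ha]
    exact ⟨h3.add h1, by rw [h3.ev_add h1, h2]⟩

lemma eventually_isRegularAt (f : RatFunc ℂ) : ∀ᶠ z in cofinite, IsRegularAt f z := by
  refine Set.Finite.subset (Polynomial.rootSet_finite f.denom ℂ) fun z hz => ?_
  simp only [IsRegularAt, ne_eq, Set.mem_compl_iff, Set.mem_ofPred_eq, not_not] at hz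
  simpa [Polynomial.mem_rootSet, f.denom_ne_zero] using hz

lemma eventually_ev_ne_zero (hf : f ≠ 0) : ∀ᶠ z in cofinite, ev z f ≠ 0 := by
  have h1 : ∀ᶠ z in cofinite, f.num.eval z ≠ 0 := by
    refine Set.Finite.subset (Polynomial.rootSet_finite f.num ℂ) fun z hz => ?_
    simp only [ne_eq, Set.mem_compl_iff, Set.mem_ofPred_eq, not_not] at hz
    simpa [Polynomial.mem_rootSet, RatFunc.num_ne_zero hf] using hz
  filter_upwards [h1, eventually_isRegularAt f] with z h2 h3
  exact div_ne_zero h2 h3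

/-- Rational functions that agree at infinitely many regular points are equal. -/
lemma eq_of_frequently_ev_eq
    (h : ∃ᶠ z in cofinite, IsRegularAt f z ∧ IsRegularAt g z ∧ ev z f = ev z g) : f = g := by
  by_contra hne
  obtain ⟨z, ⟨hf, hg, he⟩, h0⟩ :=
    (h.and_eventually (eventually_ev_ne_zero (sub_ne_zero.2 hne))).exists
  have h1 : f - g = f + RatFunc.C (-1) * g := by simp [sub_eq_add_neg]
  have h2 := (isRegularAt_C (-1) z).mul hg
  apply h0
  rw [h1, hf.ev_add h2, (isRegularAt_C (-1) z).ev_mul hg, he, ev, ev,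
    RatFunc.eval_C]
  simp

/-- A rational function that is bounded along points accumulating at `z` has no pole at `z`. -/
lemma isRegularAt_of_frequently_bounded {M : ℝ}
    (h : ∃ᶠ w in 𝓝 z, IsRegularAt f w ∧ ‖ev w f‖ ≤ M) : IsRegularAt f z := by
  intro h0
  have hcl : IsClosed {w : ℂ | ‖f.num.eval w‖ ≤ M * ‖f.denom.eval w‖} :=
    isClosed_le (by fun_prop) (by fun_prop)
  have hz : z ∈ {w : ℂ | ‖f.num.eval w‖ ≤ M * ‖f.denom.eval w‖} := by
    rw [← hcl.closure_eq, mem_closure_iff_frequently]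
    refine h.mono fun w hw => ?_
    have h1 : 0 < ‖f.denom.eval w‖ := norm_pos_iff.2 hw.1
    have h2 := hw.2
    rwa [ev_eq_div, norm_div, div_le_iff₀ h1] at h2
  simp only [Set.mem_ofPred_eq, h0, norm_zero, mul_zero, norm_le_zero_iff] at hz
  obtain ⟨u, v, huv⟩ := f.isCoprime_num_denom
  have := congrArg (Polynomial.eval z) huv
  simp [hz, h0] at this

lemma IsRegularAt.continuousAt (hf : IsRegularAt f z) : ContinuousAt (fun w => ev w f) z :=
  ContinuousAt.div (by fun_prop) (by fun_prop) hf

end RationalFunctions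

/-! ### Rational matrices and their values -/

section RationalMatrices

variable {ι κ μ : Type*} {z : ℂ}

lemma evalAt_apply (W : RatMatrix ι κ) (z : ℂ) (i : ι) (j : κ) : evalAt W z i j = ev z (W i j) :=
  rfl

lemma RegularAt.add {V W : RatMatrix ι κ} (hV : RegularAt V z) (hW : RegularAt W z) :
    RegularAt (V + W) z := fun i j => IsRegularAt.add (hV i j) (hW i j)

lemma RegularAt.evalAt_add {V W : RatMatrix ι κ} (hV : RegularAt V z) (hW : RegularAt W z) :
    evalAt (V + W) z = evalAt V z + evalAt W z := by
  ext i j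
  exact IsRegularAt.ev_add (hV i j) (hW i j)

lemma RegularAt.mul [Fintype κ] {V : RatMatrix ι κ} {W : RatMatrix κ μ} (hV : RegularAt V z)
    (hW : RegularAt W z) : RegularAt (V * W) z := fun i j =>
  (isRegularAt_sum _ _ fun a _ => IsRegularAt.mul (hV i a) (hW a j)).1

lemma RegularAt.evalAt_mul [Fintype κ] {V : RatMatrix ι κ} {W : RatMatrix κ μ}
    (hV : RegularAt V z) (hW : RegularAt W z) : evalAt (V * W) z = evalAt V z * evalAt W z := by
  ext i j
  rw [evalAt_apply, Matrix.mul_apply, Matrix.mul_apply,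
    (isRegularAt_sum _ _ fun a _ => IsRegularAt.mul (hV i a) (hW a j)).2]
  exact Finset.sum_congr rfl fun a _ => IsRegularAt.ev_mul (hV i a) (hW a j)

lemma regularAt_const (M : Matrix ι κ ℂ) (z : ℂ) : RegularAt (const M) z :=
  fun i j => isRegularAt_C (M i j) z

@[simp] lemma evalAt_const (M : Matrix ι κ ℂ) (z : ℂ) : evalAt (const M) z = M := by
  ext i j
  simp [evalAt, const]

lemma evalAt_one [DecidableEq ι] (z : ℂ) : evalAt (1 : RatMatrix ι ι) z = 1 := by
  ext i j
  by_cases h : i = j <;> simp [evalAt, Matrix.one_apply, h]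

lemma eventually_regularAt [Finite ι] [Finite κ] (W : RatMatrix ι κ) :
    ∀ᶠ z in cofinite, RegularAt W z :=
  eventually_all.2 fun i => eventually_all.2 fun j => eventually_isRegularAt (W i j)

lemma eq_of_frequently_evalAt_eq [Finite ι] [Finite κ] {V W : RatMatrix ι κ}
    (h : ∃ᶠ z in cofinite, evalAt V z = evalAt W z) : V = W := by
  ext i j
  refine eq_of_frequently_ev_eq ?_
  refine (h.and_eventually ((eventually_regularAt V).and (eventually_regularAt W))).mono ?_
  rintro z ⟨h1, h2, h3⟩
  exact ⟨h2 i j, h3 i j, congrFun (congrFun h1 i) j⟩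

/-- If the values of `W` at regular points accumulating at `z` lie in a closed set of matrices with
entries bounded by `1`, then `W` has no pole at `z` and `W(z)` lies in that set too. -/
lemma regularAt_and_evalAt_mem_of_frequently {W : RatMatrix ι κ} {T : Set (Matrix ι κ ℂ)}
    (hT : IsClosed T) (hbound : ∀ M ∈ T, ∀ i j, ‖M i j‖ ≤ 1)
    (h : ∃ᶠ w in 𝓝 z, RegularAt W w ∧ evalAt W w ∈ T) : RegularAt W z ∧ evalAt W z ∈ T := by
  have hreg : RegularAt W z := fun i j =>
    isRegularAt_of_frequently_bounded (M := 1) <| h.mono fun w hw => ⟨hw.1 i j, hbound _ hw.2 i j⟩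
  refine ⟨hreg, hT.mem_of_frequently_of_tendsto (h.mono fun w hw => hw.2) ?_⟩
  exact tendsto_pi_nhds.2 fun i => tendsto_pi_nhds.2 fun j =>
    IsRegularAt.continuousAt (hreg i j)

end RationalMatrices

/-! ### The resolvent and transfer functions -/

section Transfer

variable {n ι κ μ : Type*} [Fintype n] [DecidableEq n] {z : ℂ}

lemma const_mul [Fintype κ] (M : Matrix ι κ ℂ) (N : Matrix κ μ ℂ) :
    const (M * N) = const M * const N := Matrix.map_mul

lemma const_add (M N : Matrix ι κ ℂ) : const (M + N) = const M + const N := by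
  ext i j; simp [const]

lemma const_sub (M N : Matrix ι κ ℂ) : const (M - N) = const M - const N := by
  ext i j; simp [const]

lemma const_neg (M : Matrix ι κ ℂ) : const (-M) = -const M := by
  ext i j; simp [const]

@[simp] lemma const_zero : const (0 : Matrix ι κ ℂ) = 0 := by
  ext i j; simp [const]

@[simp] lemma const_one [DecidableEq ι] : const (1 : Matrix ι ι ℂ) = 1 := by
  ext i j; by_cases h : i = j <;> simp [const, Matrix.one_apply, h]

lemma const_transpose (M : Matrix ι κ ℂ) : (const M)ᵀ = const Mᵀ := rfl

/-- The pencil `s I - A` as a rational matrix. -/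
def pencil (A : Matrix n n ℂ) : RatMatrix n n := Matrix.scalar n RatFunc.X - const A

lemma pencil_eq_map (A : Matrix n n ℂ) :
    pencil A = (Matrix.charmatrix A).map (algebraMap (Polynomial ℂ) (RatFunc ℂ)) := by
  ext i j
  by_cases h : i = j
  · subst h
    simp [pencil, const, RatFunc.algebraMap_C]
  · simp [pencil, const, h, RatFunc.algebraMap_C]

lemma det_pencil (A : Matrix n n ℂ) : (pencil A).det = algebraMap _ (RatFunc ℂ) A.charpoly := by
  rw [pencil_eq_map, Matrix.charpoly, RingHom.map_det]
  rfl

lemma isUnit_pencil (A : Matrix n n ℂ) : IsUnit (pencil A) := by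
  rw [Matrix.isUnit_iff_isUnit_det, det_pencil, isUnit_iff_ne_zero]
  exact RatFunc.algebraMap_ne_zero A.charpoly_monic.ne_zero

lemma pencil_mul_inv (A : Matrix n n ℂ) : pencil A * (pencil A)⁻¹ = 1 :=
  Matrix.mul_nonsing_inv _ ((Matrix.isUnit_iff_isUnit_det _).1 (isUnit_pencil A))

lemma inv_mul_pencil (A : Matrix n n ℂ) : (pencil A)⁻¹ * pencil A = 1 :=
  Matrix.nonsing_inv_mul _ ((Matrix.isUnit_iff_isUnit_det _).1 (isUnit_pencil A))

lemma regularAt_pencil (A : Matrix n n ℂ) (z : ℂ) : RegularAt (pencil A) z := by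
  intro i j
  refine isRegularAt_of_mul_eq (a := Matrix.charmatrix A i j) (b := 1) (by simp) ?_
  simp [pencil_eq_map]

lemma evalAt_pencil (A : Matrix n n ℂ) (z : ℂ) : evalAt (pencil A) z = Matrix.scalar n z - A := by
  ext i j
  rw [evalAt_apply, pencil_eq_map]
  by_cases h : i = j
  · subst h
    simp [ev, RatFunc.eval_algebraMap, -map_sub]
  · simp [ev, h, RatFunc.eval_algebraMap, -map_neg]

lemma regularAt_inv_pencil {A : Matrix n n ℂ} (hz : IsUnit (Matrix.scalar n z - A)) :
    RegularAt (pencil A)⁻¹ z := by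
  intro i j
  have hdet : A.charpoly.eval z ≠ 0 := by
    rw [Matrix.eval_charpoly]
    exact ((Matrix.isUnit_iff_isUnit_det _).1 hz).ne_zero
  refine isRegularAt_of_mul_eq (a := (Matrix.charmatrix A).adjugate i j) hdet ?_
  have hu := det_pencil A
  have h0 : algebraMap _ (RatFunc ℂ) A.charpoly ≠ 0 :=
    RatFunc.algebraMap_ne_zero A.charpoly_monic.ne_zero
  rw [Matrix.inv_def, hu, Ring.inverse_eq_inv', Matrix.smul_apply, smul_eq_mul, mul_right_comm,
    inv_mul_cancel₀ h0, one_mul, pencil_eq_map]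
  have := (algebraMap (Polynomial ℂ) (RatFunc ℂ)).map_adjugate (Matrix.charmatrix A)
  exact (congrFun (congrFun this i) j).symm

lemma evalAt_inv_pencil {A : Matrix n n ℂ} (hz : IsUnit (Matrix.scalar n z - A)) :
    evalAt (pencil A)⁻¹ z = (Matrix.scalar n z - A)⁻¹ := by
  refine (Matrix.inv_eq_right_inv ?_).symm
  rw [← evalAt_pencil, ← (regularAt_pencil A z).evalAt_mul (regularAt_inv_pencil hz),
    pencil_mul_inv, evalAt_one]

lemma transfer_eq (A : Matrix n n ℂ) (B : Matrix n κ ℂ) (C : Matrix ι n ℂ) (D : Matrix ι κ ℂ) :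
    transfer A B C D = const C * (pencil A)⁻¹ * const B + const D := rfl

lemma evalAt_transfer {A : Matrix n n ℂ} (B : Matrix n κ ℂ) (C : Matrix ι n ℂ)
    (D : Matrix ι κ ℂ) (hz : IsUnit (Matrix.scalar n z - A)) :
    evalAt (transfer A B C D) z = C * (Matrix.scalar n z - A)⁻¹ * B + D := by
  have h1 := (regularAt_const C z).mul (regularAt_inv_pencil hz)
  rw [transfer_eq, (h1.mul (regularAt_const B z)).evalAt_add (regularAt_const D z),
    h1.evalAt_mul (regularAt_const B z),
    (regularAt_const C z).evalAt_mul (regularAt_inv_pencil hz), evalAt_inv_pencil hz]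
  simp

lemma eventually_isUnit_scalar_sub (A : Matrix n n ℂ) :
    ∀ᶠ z in cofinite, IsUnit (Matrix.scalar n z - A) := by
  refine Set.Finite.subset (Polynomial.rootSet_finite A.charpoly ℂ) fun z hz => ?_
  simp only [Set.mem_compl_iff, Set.mem_ofPred_eq, Matrix.isUnit_iff_isUnit_det,
    isUnit_iff_ne_zero, not_not] at hz
  rw [Polynomial.mem_rootSet]
  refine ⟨A.charpoly_monic.ne_zero, ?_⟩
  simpa [Matrix.eval_charpoly] using hz

lemma isUnit_scalar_sub_of_forall_mulVec {A : Matrix n n ℂ}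
    (h : ∀ v : n → ℂ, A *ᵥ v = z • v → v = 0) : IsUnit (Matrix.scalar n z - A) := by
  rw [Matrix.isUnit_iff_isUnit_det, isUnit_iff_ne_zero]
  intro h0
  obtain ⟨v, hv, hv0⟩ := Matrix.exists_mulVec_eq_zero_iff.2 h0
  apply hv
  apply h
  rw [Matrix.sub_mulVec, sub_eq_zero] at hv0
  rw [← hv0]
  ext i
  simp [Matrix.mulVec, dotProduct, Matrix.diagonal_apply]

lemma eq_zero_of_isUnit_scalar_sub {A : Matrix n n ℂ} (h : IsUnit (Matrix.scalar n z - A))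
    {v : n → ℂ} (hv : A *ᵥ v = z • v) : v = 0 := by
  have h1 : (Matrix.scalar n z - A) *ᵥ v = 0 := by
    rw [Matrix.sub_mulVec, hv, sub_eq_zero]
    ext i
    simp [Matrix.mulVec, dotProduct, Matrix.diagonal_apply]
  exact Matrix.eq_zero_of_mulVec_eq_zero
    ((Matrix.isUnit_iff_isUnit_det _).1 h).ne_zero h1

/-- A transfer function takes the value `D` at infinity. -/
lemma hasValueAtInfinity_transfer (A : Matrix n n ℂ) (B : Matrix n κ ℂ) (C : Matrix ι n ℂ)
    (D : Matrix ι κ ℂ) : HasValueAtInfinity (transfer A B C D) D := by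
  let _ : NormedRing (Matrix n n ℂ) := Matrix.linftyOpNormedRing
  let _ : NormedAlgebra ℂ (Matrix n n ℂ) := Matrix.linftyOpNormedAlgebra
  have _ : CompleteSpace (Matrix n n ℂ) := FiniteDimensional.complete ℂ _
  have h1 : Tendsto (fun z : ℂ => (Matrix.scalar n z - A)⁻¹) (cocompact ℂ) (𝓝 0) := by
    have := spectrum.resolvent_tendsto_cobounded (𝕜 := ℂ) A
    rw [Metric.cobounded_eq_cocompact] at this
    refine this.congr fun z => ?_
    rw [resolvent, Matrix.nonsing_inv_eq_ringInverse]
    rfl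
  have h2 : Tendsto (fun z : ℂ => C * (Matrix.scalar n z - A)⁻¹ * B + D) (cocompact ℂ) (𝓝 D) := by
    have hc : Continuous fun M : Matrix n n ℂ => C * M * B + D := by fun_prop
    have h3 := (hc.tendsto 0).comp h1
    rwa [Matrix.mul_zero, Matrix.zero_mul, zero_add] at h3
  intro i j
  have h3 : Tendsto (fun z : ℂ => (C * (Matrix.scalar n z - A)⁻¹ * B + D) i j) (cocompact ℂ)
      (𝓝 (D i j)) := tendsto_pi_nhds.1 (tendsto_pi_nhds.1 h2 i) j
  refine h3.congr' ?_
  filter_upwards [cocompact_le_cofinite (eventually_isUnit_scalar_sub A)] with z hz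
  rw [evalAt_transfer _ _ _ hz]

lemma HasValueAtInfinity.unique {W : RatMatrix ι κ} {L M : Matrix ι κ ℂ}
    (hL : HasValueAtInfinity W L) (hM : HasValueAtInfinity W M) : L = M := by
  ext i j
  exact tendsto_nhds_unique (hL i j) (hM i j)

end Transfer

/-! ### Operations on realizations -/

section Realizations

variable {n m ι κ μ : Type*} [Fintype n] [DecidableEq n] [Fintype m] [DecidableEq m]

lemma scalar_mul_eq_smul {R : Type*} [CommRing R] (a : R) (M : Matrix n κ R) :
    Matrix.scalar n a * M = a • M := by
  ext i j; simp

lemma mul_scalar_eq_smul {R : Type*} [CommRing R] (a : R) (M : Matrix ι n R) :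
    M * Matrix.scalar n a = a • M := by
  ext i j; simp [mul_comm]

lemma pencil_mul_const (A : Matrix n n ℂ) (B : Matrix n κ ℂ) :
    pencil A * const B = (RatFunc.X : RatFunc ℂ) • const B - const (A * B) := by
  rw [pencil, Matrix.sub_mul, scalar_mul_eq_smul, const_mul]

lemma const_mul_pencil (A : Matrix n n ℂ) (C : Matrix ι n ℂ) :
    const C * pencil A = (RatFunc.X : RatFunc ℂ) • const C - const (C * A) := by
  rw [pencil, Matrix.mul_sub, mul_scalar_eq_smul, const_mul]

/-- If `A U = U A'`, then `(s I - A)⁻¹ U = U (s I - A')⁻¹`. -/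
lemma inv_pencil_mul_const {A : Matrix n n ℂ} {A' : Matrix m m ℂ} {U : Matrix n m ℂ}
    (h : A * U = U * A') : (pencil A)⁻¹ * const U = const U * (pencil A')⁻¹ := by
  have h1 : pencil A * const U = const U * pencil A' := by
    rw [pencil_mul_const, const_mul_pencil, h]
  calc (pencil A)⁻¹ * const U = (pencil A)⁻¹ * (const U * (pencil A' * (pencil A')⁻¹)) := by
        rw [pencil_mul_inv, Matrix.mul_one]
    _ = (pencil A)⁻¹ * (pencil A * const U) * (pencil A')⁻¹ := by
        rw [h1]; simp only [Matrix.mul_assoc]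
    _ = const U * (pencil A')⁻¹ := by
        rw [← Matrix.mul_assoc (pencil A)⁻¹, inv_mul_pencil, Matrix.one_mul]

/-- Restriction of a realization to an invariant subspace containing the range of `B`. -/
lemma transfer_eq_of_intertwine {A : Matrix n n ℂ} {A' : Matrix m m ℂ} {U : Matrix n m ℂ}
    {B : Matrix n κ ℂ} {B' : Matrix m κ ℂ} (hA : A * U = U * A') (hB : B = U * B')
    (C : Matrix ι n ℂ) (D : Matrix ι κ ℂ) : transfer A B C D = transfer A' B' (C * U) D := by
  rw [transfer_eq, transfer_eq, hB, const_mul, const_mul, Matrix.mul_assoc,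
    ← Matrix.mul_assoc _ (const U), inv_pencil_mul_const hA]
  simp only [Matrix.mul_assoc]

lemma transfer_reindex (e : n ≃ m) (A : Matrix n n ℂ) (B : Matrix n κ ℂ) (C : Matrix ι n ℂ)
    (D : Matrix ι κ ℂ) :
    transfer A B C D =
      transfer (A.submatrix e.symm e.symm) (B.submatrix e.symm id) (C.submatrix id e.symm) D := by
  have h1 : A * (1 : Matrix n n ℂ).submatrix id e.symm =
      (1 : Matrix n n ℂ).submatrix id e.symm * A.submatrix e.symm e.symm := by
    rw [Matrix.submatrix_mul_equiv, Matrix.one_mul]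
    conv_lhs => rw [← Matrix.submatrix_id_id A]
    rw [Matrix.submatrix_mul _ _ id id e.symm Function.bijective_id |>.symm, Matrix.mul_one]
  have h2 : B = (1 : Matrix n n ℂ).submatrix id e.symm * B.submatrix e.symm id := by
    rw [Matrix.submatrix_mul_equiv, Matrix.one_mul, Matrix.submatrix_id_id]
  have h3 : C * (1 : Matrix n n ℂ).submatrix id e.symm = C.submatrix id e.symm := by
    conv_lhs => rw [← Matrix.submatrix_id_id C]
    rw [Matrix.submatrix_mul _ _ id id e.symm Function.bijective_id |>.symm, Matrix.mul_one]
  rw [transfer_eq_of_intertwine h1 h2, h3]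

lemma hasRealizationOfSize_transfer (A : Matrix n n ℂ) (B : Matrix n κ ℂ) (C : Matrix ι n ℂ)
    (D : Matrix ι κ ℂ) : HasRealizationOfSize (transfer A B C D) (Fintype.card n) :=
  ⟨_, _, _, _, transfer_reindex (Fintype.equivFin n) A B C D⟩

lemma const_fromBlocks {a b c d : Type*} (M : Matrix a b ℂ) (N : Matrix a d ℂ) (P : Matrix c b ℂ)
    (Q : Matrix c d ℂ) : const (Matrix.fromBlocks M N P Q) =
      Matrix.fromBlocks (const M) (const N) (const P) (const Q) := Matrix.fromBlocks_map ..

lemma const_fromRows {a b c : Type*} (M : Matrix a b ℂ) (N : Matrix c b ℂ) :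
    const (Matrix.fromRows M N) = Matrix.fromRows (const M) (const N) := by
  ext (i | i) j <;> rfl

lemma const_fromCols {a b c : Type*} (M : Matrix a b ℂ) (N : Matrix a c ℂ) :
    const (Matrix.fromCols M N) = Matrix.fromCols (const M) (const N) := by
  ext i (j | j) <;> rfl

lemma pencil_fromBlocks (A : Matrix n n ℂ) (M : Matrix n m ℂ) (N : Matrix m n ℂ)
    (B : Matrix m m ℂ) : pencil (Matrix.fromBlocks A M N B) =
      Matrix.fromBlocks (pencil A) (-const M) (-const N) (pencil B) := by
  ext (i | i) (j | j) <;> simp [pencil, const, Matrix.diagonal_apply]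

/-- The series connection of two realizations realizes the product. -/
lemma transfer_mul_transfer [Fintype κ] (A₁ : Matrix n n ℂ) (B₁ : Matrix n κ ℂ) (C₁ : Matrix ι n ℂ)
    (D₁ : Matrix ι κ ℂ) (A₂ : Matrix m m ℂ) (B₂ : Matrix m μ ℂ) (C₂ : Matrix κ m ℂ)
    (D₂ : Matrix κ μ ℂ) :
    transfer A₁ B₁ C₁ D₁ * transfer A₂ B₂ C₂ D₂ =
      transfer (Matrix.fromBlocks A₁ (B₁ * C₂) 0 A₂) (Matrix.fromRows (B₁ * D₂) B₂)
        (Matrix.fromCols C₁ (D₁ * C₂)) (D₁ * D₂) := by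
  have hinv : (pencil (Matrix.fromBlocks A₁ (B₁ * C₂) 0 A₂))⁻¹ =
      Matrix.fromBlocks (pencil A₁)⁻¹ ((pencil A₁)⁻¹ * const (B₁ * C₂) * (pencil A₂)⁻¹) 0
        (pencil A₂)⁻¹ := by
    refine Matrix.inv_eq_left_inv ?_
    rw [pencil_fromBlocks, Matrix.fromBlocks_multiply, ← Matrix.fromBlocks_one]
    simp [inv_mul_pencil, Matrix.mul_assoc]
  simp only [transfer_eq, hinv, const_fromRows, const_fromCols, Matrix.fromCols_mul_fromBlocks,
    Matrix.fromCols_mul_fromRows, const_mul, Matrix.mul_add, Matrix.add_mul, Matrix.mul_zero,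
    add_zero, Matrix.mul_assoc]
  abel

/-- Multiplication of a strictly proper transfer function by `s`. -/
lemma transfer_shift (A : Matrix n n ℂ) (B : Matrix n κ ℂ) (C : Matrix ι n ℂ) :
    transfer A (A * B) C (C * B) = (RatFunc.X : RatFunc ℂ) • transfer A B C 0 := by
  have h : const (A * B) = (RatFunc.X : RatFunc ℂ) • const B - pencil A * const B := by
    rw [pencil_mul_const]; abel
  rw [transfer_eq, transfer_eq, h, Matrix.mul_sub, Matrix.mul_smul, const_zero, add_zero,
    Matrix.mul_assoc (const C) _ (pencil A * const B), ← Matrix.mul_assoc _ (pencil A),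
    inv_mul_pencil, Matrix.one_mul, const_mul]
  abel

/-- A transfer function determines its Markov parameters `C A ^ k B`. -/
lemma markov_eq_of_transfer_eq {A : Matrix n n ℂ} {C : Matrix ι n ℂ} {A' : Matrix m m ℂ}
    {C' : Matrix ι m ℂ} (k : ℕ) : ∀ {B : Matrix n κ ℂ} {B' : Matrix m κ ℂ} {D D' : Matrix ι κ ℂ},
    transfer A B C D = transfer A' B' C' D' → C * A ^ k * B = C' * A' ^ k * B' := by
  have key : ∀ {B : Matrix n κ ℂ} {B' : Matrix m κ ℂ} {D D' : Matrix ι κ ℂ},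
      transfer A B C D = transfer A' B' C' D' →
        transfer A (A * B) C (C * B) = transfer A' (A' * B') C' (C' * B') := by
    intro B B' D D' h
    have hD : D = D' := (hasValueAtInfinity_transfer A B C D).unique
      (h ▸ hasValueAtInfinity_transfer A' B' C' D')
    subst hD
    rw [transfer_shift, transfer_shift]
    simp only [transfer_eq, add_left_inj, const_zero, add_zero] at h ⊢
    rw [h]
  induction k with
  | zero =>
    intro B B' D D' h
    rw [pow_zero, pow_zero, Matrix.mul_one, Matrix.mul_one]
    exact (hasValueAtInfinity_transfer _ _ _ _).unique
      (key h ▸ hasValueAtInfinity_transfer A' (A' * B') C' (C' * B'))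
  | succ k ih =>
    intro B B' D D' h
    have := ih (key h)
    simpa only [pow_succ, Matrix.mul_assoc] using this

end Realizations

/-! ### Controllability, observability and minimality -/

section Minimality

variable {n ι κ : Type*} [Fintype n] [Fintype κ]

/-- The pair `(A, B)` is controllable: no proper `A`-invariant subspace contains the range
of `B`. -/
def IsControllable (A : Matrix n n ℂ) (B : Matrix n κ ℂ) : Prop :=
  ∀ V : Submodule ℂ (n → ℂ), (∀ v ∈ V, A *ᵥ v ∈ V) → (∀ u, B *ᵥ u ∈ V) → V = ⊤

/-- The pair `(C, A)` is observable: no nonzero `A`-invariant subspace lies in the kernel of `C`. -/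
def IsObservable (A : Matrix n n ℂ) (C : Matrix ι n ℂ) : Prop :=
  ∀ V : Submodule ℂ (n → ℂ), (∀ v ∈ V, A *ᵥ v ∈ V) → (∀ v ∈ V, C *ᵥ v = 0) → V = ⊥

lemma IsControllable.isObservable_transpose {A : Matrix n n ℂ} {B : Matrix n κ ℂ}
    (h : IsControllable A B) : IsObservable Aᵀ Bᵀ := by
  intro V hV hC
  let V' : Submodule ℂ (n → ℂ) :=
    { carrier := {w | ∀ v ∈ V, v ⬝ᵥ w = 0}
      add_mem' := fun {a b} ha hb v hv => by rw [dotProduct_add, ha v hv, hb v hv, add_zero]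
      zero_mem' := fun v _ => dotProduct_zero v
      smul_mem' := fun c x hx v hv => by rw [dotProduct_smul, hx v hv, smul_zero] }
  have hV' : V' = ⊤ := by
    refine h V' (fun w hw v hv => ?_) (fun u v hv => ?_)
    · rw [Matrix.dotProduct_mulVec, ← Matrix.mulVec_transpose]
      exact hw _ (hV v hv)
    · rw [Matrix.dotProduct_mulVec, ← Matrix.mulVec_transpose, hC v hv, zero_dotProduct]
  rw [Submodule.eq_bot_iff]
  intro v hv
  refine dotProduct_eq_zero v fun w => ?_
  exact (hV' ▸ Submodule.mem_top : w ∈ V') v hv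

lemma star_dotProduct_mulVec (M : Matrix n κ ℂ) (w : n → ℂ) (u : κ → ℂ) :
    star w ⬝ᵥ (M *ᵥ u) = star (Mᴴ *ᵥ w) ⬝ᵥ u := by
  rw [Matrix.dotProduct_mulVec, Matrix.star_mulVec, Matrix.conjTranspose_conjTranspose]

lemma IsControllable.isObservable_conjTranspose {A : Matrix n n ℂ} {B : Matrix n κ ℂ}
    (h : IsControllable A B) : IsObservable Aᴴ Bᴴ := by
  intro V hV hC
  let V' : Submodule ℂ (n → ℂ) :=
    { carrier := {w | ∀ v ∈ V, star v ⬝ᵥ w = 0}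
      add_mem' := fun {a b} ha hb v hv => by rw [dotProduct_add, ha v hv, hb v hv, add_zero]
      zero_mem' := fun v _ => dotProduct_zero (star v)
      smul_mem' := fun c x hx v hv => by rw [dotProduct_smul, hx v hv, smul_zero] }
  have hV' : V' = ⊤ := by
    refine h V' (fun w hw v hv => ?_) (fun u v hv => ?_)
    · rw [star_dotProduct_mulVec]
      exact hw _ (hV v hv)
    · rw [star_dotProduct_mulVec, hC v hv, star_zero, zero_dotProduct]
  rw [Submodule.eq_bot_iff]
  intro v hv
  exact dotProduct_star_self_eq_zero.1 ((hV' ▸ Submodule.mem_top : v ∈ V') v hv)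

lemma IsObservable.isControllable_conjTranspose [DecidableEq n] [Fintype ι] {A : Matrix n n ℂ} {C : Matrix ι n ℂ}
    (h : IsObservable A C) : IsControllable Aᴴ Cᴴ := by
  intro V hV hB
  let V' : Submodule ℂ (n → ℂ) :=
    { carrier := {w | ∀ v ∈ V, star v ⬝ᵥ w = 0}
      add_mem' := fun {a b} ha hb v hv => by rw [dotProduct_add, ha v hv, hb v hv, add_zero]
      zero_mem' := fun v _ => dotProduct_zero (star v)
      smul_mem' := fun c x hx v hv => by rw [dotProduct_smul, hx v hv, smul_zero] }
  have hV' : V' = ⊥ := by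
    refine h V' (fun w hw v hv => ?_) (fun w hw => ?_)
    · rw [star_dotProduct_mulVec]
      exact hw _ (hV v hv)
    · refine dotProduct_star_self_eq_zero.1 ?_
      rw [star_dotProduct_mulVec]
      exact hw _ (hB _)
  by_contra hne
  obtain ⟨f, hf, hVf⟩ := V.exists_le_ker_of_lt_top (lt_top_iff_ne_top.2 hne)
  have hfx : ∀ x, f x = ∑ i, x i * f (Pi.single i 1) := fun x => by
    conv_lhs => rw [← Finset.univ_sum_single x, map_sum]
    refine Finset.sum_congr rfl fun i _ => ?_
    rw [← smul_eq_mul, ← map_smul, ← Pi.single_smul', smul_eq_mul, mul_one]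
  have hw : (fun i => star (f (Pi.single i 1))) ∈ V' := by
    intro v hv
    have h1 : f v = 0 := hVf hv
    rw [hfx] at h1
    have := congrArg star h1
    rw [star_zero, star_sum] at this
    rw [← this]
    exact Finset.sum_congr rfl fun i _ => by rw [star_mul', Pi.star_apply]
  rw [hV', Submodule.mem_bot] at hw
  apply hf
  ext i
  simpa using congrFun hw i

/-- The Hautus test: an unobservable subspace contains an eigenvector. -/
lemma isObservable_of_forall_eigenvector {A : Matrix n n ℂ} {C : Matrix ι n ℂ}
    (h : ∀ (z : ℂ) (v : n → ℂ), A *ᵥ v = z • v → C *ᵥ v = 0 → v = 0) : IsObservable A C := by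
  intro V hV hC
  by_contra hne
  have : Nontrivial V := V.nontrivial_iff_ne_bot.2 hne
  obtain ⟨z, hz⟩ := Module.End.exists_eigenvalue (A.mulVecLin.restrict hV)
  obtain ⟨v, hv⟩ := hz.exists_hasEigenvector
  apply hv.2
  ext1
  refine h z v ?_ (hC v v.2)
  exact congrArg Subtype.val hv.apply_eq_smul

/-- Observability implies that no eigenvector of `A` is killed by `C`. -/
lemma IsObservable.eq_zero {A : Matrix n n ℂ} {C : Matrix ι n ℂ} (h : IsObservable A C) {z : ℂ}
    {v : n → ℂ} (hv : A *ᵥ v = z • v) (hC : C *ᵥ v = 0) : v = 0 := by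
  have := h (Submodule.span ℂ {v}) (fun w hw => ?_) (fun w hw => ?_)
  · rwa [Submodule.span_singleton_eq_bot] at this
  · obtain ⟨c, rfl⟩ := Submodule.mem_span_singleton.1 hw
    rw [Matrix.mulVec_smul, hv]
    exact Submodule.smul_mem _ _ (Submodule.smul_mem _ _ (Submodule.mem_span_singleton_self v))
  · obtain ⟨c, rfl⟩ := Submodule.mem_span_singleton.1 hw
    rw [Matrix.mulVec_smul, hC, smul_zero]

lemma IsObservable.eq_zero_of_forall_pow [DecidableEq n] {A : Matrix n n ℂ} {C : Matrix ι n ℂ}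
    (h : IsObservable A C) {v : n → ℂ} (hv : ∀ k : ℕ, (C * A ^ k) *ᵥ v = 0) : v = 0 := by
  let V : Submodule ℂ (n → ℂ) :=
    { carrier := {w | ∀ k : ℕ, (C * A ^ k) *ᵥ w = 0}
      add_mem' := fun {a b} ha hb k => by rw [Matrix.mulVec_add, ha k, hb k, add_zero]
      zero_mem' := fun k => Matrix.mulVec_zero _
      smul_mem' := fun c x hx k => by rw [Matrix.mulVec_smul, hx k, smul_zero] }
  have hV : V = ⊥ := by
    refine h V (fun w hw k => ?_) (fun w hw => by simpa using hw 0)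
    have := hw (k + 1)
    rwa [pow_succ, ← Matrix.mul_assoc, ← Matrix.mulVec_mulVec] at this
  exact (Submodule.mem_bot ℂ).1 (hV ▸ (show v ∈ V from hv))

/-- State feedback preserves controllability. -/
lemma IsControllable.add_mul {A : Matrix n n ℂ} {B : Matrix n κ ℂ} (h : IsControllable A B)
    (K : Matrix κ n ℂ) : IsControllable (A + B * K) B := by
  intro V hV hB
  refine h V (fun v hv => ?_) hB
  have h1 := V.sub_mem (hV v hv) (hB (K *ᵥ v))
  rwa [Matrix.add_mulVec, Matrix.mulVec_mulVec, add_sub_cancel_right] at h1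

/-- Output injection preserves observability. -/
lemma IsObservable.add_mul [Fintype ι] {A : Matrix n n ℂ} {C : Matrix ι n ℂ} (h : IsObservable A C)
    (K : Matrix n ι ℂ) : IsObservable (A + K * C) C := by
  intro V hV hC
  refine h V (fun v hv => ?_) hC
  have h1 := hV v hv
  rwa [Matrix.add_mulVec, ← Matrix.mulVec_mulVec, hC v hv, Matrix.mulVec_zero, add_zero] at h1

lemma IsControllable.mul_isUnit {n ι : Type*} [Fintype n] [Fintype ι] [DecidableEq ι] {A : Matrix n n ℂ} {B : Matrix n ι ℂ} (h : IsControllable A B)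
    {M : Matrix ι ι ℂ} (hM : IsUnit M) : IsControllable A (B * M) := by
  intro V hV hB
  refine h V hV fun u => ?_
  have := hB (M⁻¹ *ᵥ u)
  rwa [Matrix.mulVec_mulVec, Matrix.mul_assoc,
    Matrix.mul_nonsing_inv _ ((Matrix.isUnit_iff_isUnit_det _).1 hM), Matrix.mul_one] at this

lemma IsControllable.fromCols {n κ κ' : Type*} [Fintype n] [Fintype κ] [Fintype κ']
    {A : Matrix n n ℂ} {B : Matrix n κ ℂ} (h : IsControllable A B) (B' : Matrix n κ' ℂ) :
    IsControllable A (Matrix.fromCols B' B) := by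
  intro V hV hB
  refine h V hV fun u => ?_
  have := hB (Sum.elim 0 u)
  rwa [Matrix.fromCols_mulVec, Sum.elim_comp_inl, Sum.elim_comp_inr, Matrix.mulVec_zero,
    zero_add] at this

lemma IsObservable.isUnit_mul {n ι : Type*} [Fintype n] [Fintype ι] [DecidableEq ι]
    {A : Matrix n n ℂ} {C : Matrix ι n ℂ} (h : IsObservable A C) {M : Matrix ι ι ℂ}
    (hM : IsUnit M) : IsObservable A (M * C) := by
  intro V hV hC
  refine h V hV fun v hv => ?_
  have h1 := hC v hv
  rw [← Matrix.mulVec_mulVec] at h1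
  exact Matrix.eq_zero_of_mulVec_eq_zero ((Matrix.isUnit_iff_isUnit_det _).1 hM).ne_zero h1

/-- A realization of minimal size is controllable. -/
lemma isControllable_of_mcMillanDegree {k : ℕ} {A : Matrix (Fin k) (Fin k) ℂ}
    {B : Matrix (Fin k) κ ℂ} {C : Matrix ι (Fin k) ℂ} {D : Matrix ι κ ℂ}
    (h : mcMillanDegree (transfer A B C D) = k) : IsControllable A B := by
  intro V hV hB
  let b := Module.finBasis ℂ V
  let U : Matrix (Fin k) (Fin (Module.finrank ℂ V)) ℂ := .of fun i j => (b j : Fin k → ℂ) i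
  have hU : ∀ v : V, U *ᵥ (b.repr v) = v := fun v => by
    conv_rhs => rw [← b.sum_repr v]
    ext i
    simp only [U, Matrix.mulVec, dotProduct, Matrix.of_apply, Submodule.coe_sum,
      Submodule.coe_smul, Finset.sum_apply, Pi.smul_apply, smul_eq_mul]
    exact Finset.sum_congr rfl fun _ _ => mul_comm _ _
  classical
  have h1 : A * U = U * .of fun i j => b.repr ⟨A *ᵥ (b j), hV _ (b j).2⟩ i := by
    ext i j
    exact (congrFun (hU ⟨A *ᵥ (b j), hV _ (b j).2⟩) i).symm
  have h2 : B = U * .of fun i j => b.repr ⟨B *ᵥ (Pi.single j 1), hB _⟩ i := by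
    ext i j
    refine Eq.trans ?_ (congrFun (hU ⟨B *ᵥ (Pi.single j 1), hB _⟩) i).symm
    simp
  have h3 : HasRealizationOfSize (transfer A B C D) (Module.finrank ℂ V) :=
    ⟨_, _, _, _, transfer_eq_of_intertwine h1 h2 C D⟩
  have h4 : (k : ℕ∞) ≤ (Module.finrank ℂ V : ℕ) := by
    rw [← h]
    exact iInf₂_le (f := fun (n : ℕ) (_ : HasRealizationOfSize (transfer A B C D) n) => (n : ℕ∞))
      _ h3
  refine Submodule.eq_top_of_finrank_eq (le_antisymm (Submodule.finrank_le V) ?_)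
  simpa using h4

/-- A controllable and observable realization is minimal. -/
lemma mcMillanDegree_transfer [DecidableEq n] {A : Matrix n n ℂ} {B : Matrix n κ ℂ} {C : Matrix ι n ℂ}
    (hB : IsControllable A B) (hC : IsObservable A C) (D : Matrix ι κ ℂ) :
    mcMillanDegree (transfer A B C D) = Fintype.card n := by
  refine le_antisymm (iInf₂_le _ (hasRealizationOfSize_transfer A B C D)) (le_iInf₂ fun d hd => ?_)
  obtain ⟨A', B', C', D', h⟩ := hd
  -- every state has a counterpart in the other realization with the same free output
  let V : Submodule ℂ (n → ℂ) :=
    { carrier := {v | ∃ w, ∀ k : ℕ, (C * A ^ k) *ᵥ v = (C' * A' ^ k) *ᵥ w}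
      add_mem' := fun {a b} ⟨x, hx⟩ ⟨y, hy⟩ => ⟨x + y, fun k => by
        rw [Matrix.mulVec_add, Matrix.mulVec_add, hx, hy]⟩
      zero_mem' := ⟨0, fun k => by simp⟩
      smul_mem' := fun c x ⟨y, hy⟩ => ⟨c • y, fun k => by
        rw [Matrix.mulVec_smul, Matrix.mulVec_smul, hy]⟩ }
  have hV : V = ⊤ := by
    refine hB V ?_ (fun u => ⟨B' *ᵥ u, fun k => ?_⟩)
    · rintro v ⟨w, hw⟩
      refine ⟨A' *ᵥ w, fun k => ?_⟩
      have := hw (k + 1)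
      simpa only [pow_succ, Matrix.mulVec_mulVec, Matrix.mul_assoc] using this
    · rw [Matrix.mulVec_mulVec, Matrix.mulVec_mulVec, markov_eq_of_transfer_eq k h]
  have hmem : ∀ v, ∃ w, ∀ k : ℕ, (C * A ^ k) *ᵥ v = (C' * A' ^ k) *ᵥ w :=
    fun v => (hV ▸ Submodule.mem_top : v ∈ V)
  choose F hF using fun j : n => hmem (Pi.single j 1)
  let T : Matrix (Fin d) n ℂ := .of fun i j => F j i
  have hT : ∀ (k : ℕ), C * A ^ k = C' * A' ^ k * T := fun k => by
    ext i j
    have := congrFun (hF j k) i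
    rw [Matrix.mulVec_single_one] at this
    exact this
  have hinj : Function.Injective T.mulVecLin := by
    rw [← LinearMap.ker_eq_bot, LinearMap.ker_eq_bot']
    intro v hv
    refine hC.eq_zero_of_forall_pow fun k => ?_
    rw [hT, ← Matrix.mulVec_mulVec, ← Matrix.mulVecLin_apply T, hv, Matrix.mulVec_zero]
  have := LinearMap.finrank_le_finrank_of_injective hinj
  simp only [Module.finrank_fintype_fun_eq_card, Fintype.card_fin] at this
  exact_mod_cast this

/-- In a controllable and observable realization every eigenvalue of `A` is a pole. -/
lemma isUnit_of_regularAt_transfer [DecidableEq n] {A : Matrix n n ℂ} {B : Matrix n κ ℂ} {C : Matrix ι n ℂ}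
    {D : Matrix ι κ ℂ} (hB : IsControllable A B) (hC : IsObservable A C) {z : ℂ}
    (hz : RegularAt (transfer A B C D) z) : IsUnit (Matrix.scalar n z - A) := by
  -- the vectors `v` for which `C (s I - A)⁻¹ v` has no pole at `z`
  let col (v : n → ℂ) : RatMatrix n Unit := const (Matrix.replicateCol Unit v)
  have hadd : ∀ v w, col (v + w) = col v + col w := fun v w => by
    rw [← const_add]; rfl
  have hsmul : ∀ (c : ℂ) v, col (c • v) = (RatFunc.C c : RatFunc ℂ) • col v := fun c v => by
    ext i j; simp [col, const]
  have hcmul : ∀ (c : ℂ) {α β : Type _} (W : RatMatrix α β), RegularAt W z →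
      RegularAt ((RatFunc.C c : RatFunc ℂ) • W) z := fun c α β W hW i j =>
    (isRegularAt_C c z).mul (hW i j)
  let V : Submodule ℂ (n → ℂ) :=
    { carrier := {v | RegularAt (const C * (pencil A)⁻¹ * col v) z}
      add_mem' := fun {a b} ha hb => by
        rw [Set.mem_ofPred_eq, hadd, Matrix.mul_add]
        exact RegularAt.add ha hb
      zero_mem' := by
        have : col 0 = 0 := by ext i j; simp [col, const]
        rw [Set.mem_ofPred_eq, this, Matrix.mul_zero]
        exact fun i j => isRegularAt_zero z
      smul_mem' := fun c x hx => by
        rw [Set.mem_ofPred_eq, hsmul, Matrix.mul_smul]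
        exact hcmul c _ hx }
  have hV : V = ⊤ := by
    refine hB V (fun v hv => ?_) (fun u => ?_)
    · have h1 : const C * (pencil A)⁻¹ * col (A *ᵥ v) =
          (RatFunc.X : RatFunc ℂ) • (const C * (pencil A)⁻¹ * col v) +
            const (-(C * Matrix.replicateCol Unit v)) := by
        have := transfer_shift A (Matrix.replicateCol Unit v) C
        rw [transfer_eq, transfer_eq, const_zero, add_zero] at this
        rw [const_neg, ← this, add_neg_cancel_right]
        rw [show A * Matrix.replicateCol Unit v = Matrix.replicateCol Unit (A *ᵥ v) by
          rw [Matrix.replicateCol_mulVec]]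
      show RegularAt _ z
      rw [h1]
      refine RegularAt.add (fun i j => (isRegularAt_X z).mul (hv i j)) (regularAt_const _ z)
    · show RegularAt _ z
      have h1 : const C * (pencil A)⁻¹ * col (B *ᵥ u) =
          (transfer A B C D + const (-D)) * const (Matrix.replicateCol Unit u) := by
        rw [transfer_eq, const_neg, add_neg_cancel_right]
        simp only [col]
        rw [Matrix.replicateCol_mulVec, const_mul]
        simp only [Matrix.mul_assoc]
      rw [h1]
      exact (hz.add (regularAt_const _ z)).mul (regularAt_const _ z)
  refine isUnit_scalar_sub_of_forall_mulVec fun v hv => hC.eq_zero hv ?_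
  have hCG : RegularAt (const C * (pencil A)⁻¹) z := by
    intro i j
    have h1 : RegularAt (const C * (pencil A)⁻¹ * col (Pi.single j 1)) z :=
      (hV ▸ Submodule.mem_top : Pi.single j 1 ∈ V)
    have h2 := h1 i ()
    have h3 : (const C * (pencil A)⁻¹ * col (Pi.single j 1)) i () =
        (const C * (pencil A)⁻¹) i j := by
      rw [Matrix.mul_apply, Finset.sum_eq_single j]
      · rw [show col (Pi.single j 1) j () = 1 by simp [col, const], mul_one]
      · intro b _ hb
        rw [show col (Pi.single j 1) b () = 0 by simp [col, const, hb], mul_zero]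
      · simp
    rwa [h3] at h2
  have h2 : evalAt (const C * (pencil A)⁻¹) z * (Matrix.scalar n z - A) = C := by
    rw [← evalAt_pencil, ← hCG.evalAt_mul (regularAt_pencil A z), Matrix.mul_assoc,
      inv_mul_pencil, Matrix.mul_one, evalAt_const]
  rw [← h2, ← Matrix.mulVec_mulVec, Matrix.sub_mulVec, hv]
  have : Matrix.scalar n z *ᵥ v = z • v := by
    ext i
    simp [Matrix.mulVec, dotProduct, Matrix.diagonal_apply]
  rw [this, sub_self, Matrix.mulVec_zero]

end Minimality

/-! ### Lyapunov equations -/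

section Lyapunov

variable {n κ : Type*} [Fintype n] [Fintype κ]

/-- All eigenvalues of `A` lie in the open left half-plane. -/
def IsStable [DecidableEq n] (A : Matrix n n ℂ) : Prop := ∀ z : ℂ, 0 ≤ z.re → IsUnit (Matrix.scalar n z - A)

lemma isUnit_scalar_sub_conjTranspose [DecidableEq n] {A : Matrix n n ℂ} {z : ℂ} :
    IsUnit (Matrix.scalar n (star z) - Aᴴ) ↔ IsUnit (Matrix.scalar n z - A) := by
  rw [show Matrix.scalar n (star z) - Aᴴ = (Matrix.scalar n z - A)ᴴ by
    rw [Matrix.conjTranspose_sub]; congr 1; ext i j; simp [Matrix.diagonal_apply, apply_ite star, eq_comm]]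
  exact isUnit_star

/-- The value of a Lyapunov equation at a left eigenvector of `A`. -/
lemma lyapunov_eigenvector {A P : Matrix n n ℂ} {B : Matrix n κ ℂ}
    (h : A * P + P * Aᴴ + B * Bᴴ = 0) {z : ℂ} {v : n → ℂ} (hv : Aᴴ *ᵥ v = z • v) :
    (star z + z) * (star v ⬝ᵥ (P *ᵥ v)) + star (Bᴴ *ᵥ v) ⬝ᵥ (Bᴴ *ᵥ v) = 0 := by
  have h1 : star v ⬝ᵥ ((A * P + P * Aᴴ + B * Bᴴ) *ᵥ v) = 0 := by simp [h]
  rw [Matrix.add_mulVec, Matrix.add_mulVec, dotProduct_add, dotProduct_add,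
    ← Matrix.mulVec_mulVec, ← Matrix.mulVec_mulVec, ← Matrix.mulVec_mulVec, hv,
    star_dotProduct_mulVec A, star_dotProduct_mulVec B, hv, Matrix.mulVec_smul, star_smul,
    dotProduct_smul, smul_dotProduct] at h1
  rw [← h1, smul_eq_mul, smul_eq_mul]
  ring

/-- A solvable Lyapunov equation with controllable `(A, B)` excludes eigenvalues of `A` on the
imaginary axis. -/
lemma isStable_of_lyapunov [DecidableEq n] {A P : Matrix n n ℂ} {B : Matrix n κ ℂ}
    (h : A * P + P * Aᴴ + B * Bᴴ = 0) (hB : IsControllable A B)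
    (hA : ∀ z : ℂ, 0 < z.re → IsUnit (Matrix.scalar n z - A)) : IsStable A := by
  intro z hz
  rcases hz.lt_or_eq with hz | hz
  · exact hA z hz
  rw [← isUnit_scalar_sub_conjTranspose]
  refine isUnit_scalar_sub_of_forall_mulVec fun v hv => ?_
  have h1 := lyapunov_eigenvector h hv
  have h2 : star (star z) + star z = 0 := by
    apply Complex.ext <;> simp [← hz]
  rw [h2, zero_mul, zero_add] at h1
  exact hB.isObservable_conjTranspose.eq_zero hv (dotProduct_star_self_eq_zero.1 h1)

/-- If a Lyapunov equation has a positive definite solution and `A` is stable, then `(A, B)` is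
controllable, here in its dual form. -/
lemma IsStable.isObservable_conjTranspose [DecidableEq n] {A P : Matrix n n ℂ} {B : Matrix n κ ℂ} (hA : IsStable A)
    (h : A * P + P * Aᴴ + B * Bᴴ = 0) (hP : P.PosDef) : IsObservable Aᴴ Bᴴ := by
  refine isObservable_of_forall_eigenvector fun z v hv hB => ?_
  by_contra hv0
  have h1 := lyapunov_eigenvector h hv
  rw [hB, dotProduct_zero, add_zero] at h1
  have h2 : star z + z = 0 :=
    (mul_eq_zero.1 h1).resolve_right (hP.dotProduct_mulVec_pos hv0).ne'
  have h3 : z.re = 0 := by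
    have := congrArg Complex.re h2
    simp at this
    linarith
  apply hv0
  refine eq_zero_of_isUnit_scalar_sub (A := Aᴴ) (z := z) ?_ hv
  have := hA (star z) (by simp [h3])
  rwa [← isUnit_scalar_sub_conjTranspose, star_star] at this

lemma isClosed_posSemidef : IsClosed {M : Matrix n n ℂ | M.PosSemidef} := by
  simp only [Matrix.posSemidef_iff_dotProduct_mulVec, Set.ofPred_and, Set.ofPred_forall]
  refine IsClosed.inter (isClosed_eq (by fun_prop) continuous_id) (isClosed_iInter fun x => ?_)
  exact isClosed_le continuous_const (by fun_prop)

/-- Powers of a matrix with all eigenvalues in the open unit disc tend to zero. -/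
lemma tendsto_pow_zero_of_eigenvalues [DecidableEq n] {F : Matrix n n ℂ}
    (hF : ∀ (z : ℂ) (v : n → ℂ), F *ᵥ v = z • v → v ≠ 0 → ‖z‖ < 1) :
    Tendsto (fun k : ℕ => F ^ k) atTop (𝓝 0) := by
  cases isEmpty_or_nonempty n
  · exact tendsto_const_nhds.congr fun k => Subsingleton.elim _ _
  let _ : NormedRing (Matrix n n ℂ) := Matrix.linftyOpNormedRing
  let _ : NormedAlgebra ℂ (Matrix n n ℂ) := Matrix.linftyOpNormedAlgebra
  have _ : CompleteSpace (Matrix n n ℂ) := FiniteDimensional.complete ℂ _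
  have h1 : spectralRadius ℂ F < (1 : NNReal) := by
    refine spectrum.spectralRadius_lt_of_forall_lt F fun z hz => ?_
    rw [spectrum.mem_iff] at hz
    have h2 : ¬ ∀ v : n → ℂ, F *ᵥ v = z • v → v = 0 :=
      fun h => hz (isUnit_scalar_sub_of_forall_mulVec h)
    push Not at h2
    obtain ⟨v, hv, hv0⟩ := h2
    exact hF z v hv hv0
  obtain ⟨r, hr1, hr2⟩ := ENNReal.lt_iff_exists_nnreal_btwn.1 h1
  have hr2' : r < 1 := by exact_mod_cast hr2
  have h3 := (spectrum.pow_nnnorm_pow_one_div_tendsto_nhds_spectralRadius F).eventually_lt_const hr1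
  refine tendsto_zero_iff_norm_tendsto_zero.2 ?_
  refine squeeze_zero' (g := fun k => (r : ℝ) ^ k) (Eventually.of_forall fun k => norm_nonneg _) ?_
    (tendsto_pow_atTop_nhds_zero_of_lt_one r.2 hr2')
  filter_upwards [h3, eventually_gt_atTop 0] with k hk hk0
  have hk1 : (k : ℝ) ≠ 0 := by positivity
  have h4 := ENNReal.rpow_le_rpow hk.le (Nat.cast_nonneg k)
  rw [← ENNReal.rpow_mul, one_div, inv_mul_cancel₀ hk1, ENNReal.rpow_one,
    ENNReal.rpow_natCast] at h4
  have h5 : ‖F ^ k‖₊ ≤ r ^ k := by exact_mod_cast h4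
  exact_mod_cast h5

/-- The solution of a Lyapunov equation with stable `A` is positive semidefinite. The Cayley
transform `F = (1 - A)⁻¹ (1 + A)` turns the equation into the Stein equation
`P - F P Fᴴ = 2 (1 - A)⁻¹ B Bᴴ (1 - A)⁻ᴴ`, whose iterates decrease from `P` to zero. -/
lemma IsStable.posSemidef_of_lyapunov [DecidableEq n] {A P : Matrix n n ℂ} {B : Matrix n κ ℂ} (hA : IsStable A)
    (h : A * P + P * Aᴴ + B * Bᴴ = 0) : P.PosSemidef := by
  have hu : IsUnit (1 - A).det := by
    have := hA 1 (by simp)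
    rwa [map_one, Matrix.isUnit_iff_isUnit_det] at this
  set R := (1 - A)⁻¹ with hR
  have hR1 : R * (1 - A) = 1 := Matrix.nonsing_inv_mul _ hu
  have hR2 : (1 - A) * R = 1 := Matrix.mul_nonsing_inv _ hu
  have hcomm : R * (1 + A) = (1 + A) * R := by
    calc R * (1 + A) = R * ((1 + A) * ((1 - A) * R)) := by rw [hR2, mul_one]
      _ = R * ((1 - A) * (1 + A)) * R := by noncomm_ring
      _ = (1 + A) * R := by rw [← mul_assoc R, hR1, one_mul]
  set F := R * (1 + A) with hF
  have hpow : Tendsto (fun k : ℕ => F ^ k) atTop (𝓝 0) := by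
    refine tendsto_pow_zero_of_eigenvalues fun z v hv hv0 => ?_
    have h1 : (1 + A) *ᵥ v = z • ((1 - A) *ᵥ v) := by
      rw [← Matrix.mulVec_smul, ← hv, Matrix.mulVec_mulVec, hF, ← mul_assoc, hR2, one_mul]
    have h2 : (1 + z) • (A *ᵥ v) = (z - 1) • v := by
      rw [Matrix.add_mulVec, Matrix.sub_mulVec, Matrix.one_mulVec] at h1
      have : (1 + z) • (A *ᵥ v) - (z - 1) • v = (v + A *ᵥ v) - z • (v - A *ᵥ v) := by
        module
      rw [← sub_eq_zero, this, h1, sub_self]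
    have hz : 1 + z ≠ 0 := by
      intro h0
      rw [h0, zero_smul, eq_neg_of_add_eq_zero_right h0] at h2
      exact (smul_ne_zero (by norm_num) hv0) h2.symm
    have h3 : A *ᵥ v = ((z - 1) / (1 + z)) • v := by
      rw [div_eq_inv_mul, mul_smul, ← h2, smul_smul, inv_mul_cancel₀ hz, one_smul]
    have h4 : ((z - 1) / (1 + z)).re < 0 := by
      by_contra h5
      exact hv0 (eq_zero_of_isUnit_scalar_sub (hA _ (not_lt.1 h5)) h3)
    have h5 : ((z - 1) / (1 + z)).re = (Complex.normSq z - 1) / Complex.normSq (1 + z) := by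
      rw [Complex.div_re, Complex.normSq_apply z]
      simp
      ring
    rw [h5, div_neg_iff] at h4
    have h6 := Complex.normSq_nonneg (1 + z)
    have h7 : Complex.normSq z < 1 := by
      rcases h4 with h4 | h4 <;> linarith [h4.1, h4.2]
    rw [Complex.normSq_eq_norm_sq] at h7
    exact (sq_lt_one_iff₀ (norm_nonneg z)).1 h7
  have hstein : P - F * P * Fᴴ = (R * B) * (R * B)ᴴ + (R * B) * (R * B)ᴴ := by
    have h1 : (1 - A) * P * (1 - A)ᴴ - (1 + A) * P * (1 + A)ᴴ = B * Bᴴ + B * Bᴴ := by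
      have : B * Bᴴ = -(A * P + P * Aᴴ) := by rw [eq_neg_iff_add_eq_zero, add_comm]; exact h
      rw [this, Matrix.conjTranspose_add, Matrix.conjTranspose_sub, Matrix.conjTranspose_one]
      noncomm_ring
    have hR3 : (1 - A)ᴴ * Rᴴ = 1 := by
      rw [← Matrix.conjTranspose_mul, hR1, Matrix.conjTranspose_one]
    calc P - F * P * Fᴴ = (R * (1 - A)) * P * ((1 - A)ᴴ * Rᴴ) - F * P * Fᴴ := by
          rw [hR1, hR3, one_mul, mul_one]
      _ = R * ((1 - A) * P * (1 - A)ᴴ - (1 + A) * P * (1 + A)ᴴ) * Rᴴ := by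
          rw [hF, Matrix.conjTranspose_mul]; noncomm_ring
      _ = _ := by
          rw [h1, Matrix.conjTranspose_mul]
          simp only [Matrix.mul_add, Matrix.add_mul, Matrix.mul_assoc]
  have hdec : ∀ k : ℕ, (P - F ^ k * P * (F ^ k)ᴴ).PosSemidef := by
    intro k
    induction k with
    | zero => simpa using Matrix.PosSemidef.zero
    | succ k ih =>
      have : P - F ^ (k + 1) * P * (F ^ (k + 1))ᴴ =
          (P - F ^ k * P * (F ^ k)ᴴ) + F ^ k * (P - F * P * Fᴴ) * (F ^ k)ᴴ := by
        rw [pow_succ, Matrix.conjTranspose_mul]; noncomm_ring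
      rw [this, hstein]
      exact ih.add (((Matrix.posSemidef_self_mul_conjTranspose _).add
        (Matrix.posSemidef_self_mul_conjTranspose _)).mul_mul_conjTranspose_same _)
  have hlim : Tendsto (fun k : ℕ => P - F ^ k * P * (F ^ k)ᴴ) atTop (𝓝 P) := by
    have hc : Continuous fun M : Matrix n n ℂ => P - M * P * Mᴴ := by fun_prop
    have := (hc.tendsto 0).comp hpow
    rw [Matrix.zero_mul, Matrix.zero_mul, sub_zero] at this
    exact this
  exact isClosed_posSemidef.mem_of_tendsto hlim (Eventually.of_forall hdec)

end Lyapunov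

/-! ### Lossless realizations -/

section Lossless

variable {n m ι ι' : Type*} [Fintype n] [Fintype m] [Fintype ι] [DecidableEq ι] [Fintype ι']

/-- A realization that is lossless with respect to the Hermitian matrix `P`. The transfer function
is then unitary on the imaginary axis, and a Schur function if `P` is positive semidefinite. -/
structure IsLossless {n ι : Type*} [Fintype n] [Fintype ι] [DecidableEq ι] (A : Matrix n n ℂ) (B : Matrix n ι ℂ) (C : Matrix ι n ℂ) (D : Matrix ι ι ℂ)
    (P : Matrix n n ℂ) : Prop where
  isHermitian : P.IsHermitian
  lyapunov : A * P + P * Aᴴ + B * Bᴴ = 0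
  cross : B * Dᴴ + P * Cᴴ = 0
  unitary : D * Dᴴ = 1

variable {A : Matrix n n ℂ} {B : Matrix n ι ℂ} {C : Matrix ι n ℂ} {D : Matrix ι ι ℂ}
  {P : Matrix n n ℂ}

lemma IsLossless.cross_conjTranspose (h : IsLossless A B C D P) : D * Bᴴ + C * P = 0 := by
  have := congrArg Matrix.conjTranspose h.cross
  rwa [Matrix.conjTranspose_add, Matrix.conjTranspose_mul, Matrix.conjTranspose_mul,
    Matrix.conjTranspose_conjTranspose, Matrix.conjTranspose_conjTranspose,
    h.isHermitian.eq, Matrix.conjTranspose_zero] at this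

/-- The energy balance of a lossless realization. -/
lemma IsLossless.one_sub_evalAt_mul [DecidableEq n] (h : IsLossless A B C D P) {z : ℂ}
    (hz : IsUnit (Matrix.scalar n z - A)) :
    1 - evalAt (transfer A B C D) z * (evalAt (transfer A B C D) z)ᴴ =
      (z + star z) • (C * (Matrix.scalar n z - A)⁻¹ * P * (C * (Matrix.scalar n z - A)⁻¹)ᴴ) := by
  rw [evalAt_transfer _ _ _ hz]
  set M := Matrix.scalar n z - A with hM
  have hd := (Matrix.isUnit_iff_isUnit_det _).1 hz
  have h1 : M⁻¹ * M = 1 := Matrix.nonsing_inv_mul _ hd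
  have h2 : Mᴴ * M⁻¹ᴴ = 1 := by rw [← Matrix.conjTranspose_mul, h1, Matrix.conjTranspose_one]
  have hMH : Mᴴ = Matrix.scalar n (star z) - Aᴴ := by
    rw [hM, Matrix.conjTranspose_sub]; congr 1
    ext i j; simp [Matrix.diagonal_apply, apply_ite star, eq_comm]
  have h3 : B * Bᴴ = M * P + P * Mᴴ - (z + star z) • P := by
    rw [hMH, hM, Matrix.sub_mul, Matrix.mul_sub, scalar_mul_eq_smul, mul_scalar_eq_smul, add_smul]
    rw [← sub_eq_zero, ← h.lyapunov]
    abel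
  have h4 : M⁻¹ * (B * Bᴴ) * M⁻¹ᴴ = P * M⁻¹ᴴ + M⁻¹ * P - (z + star z) • (M⁻¹ * P * M⁻¹ᴴ) := by
    calc M⁻¹ * (B * Bᴴ) * M⁻¹ᴴ = (M⁻¹ * M) * P * M⁻¹ᴴ + M⁻¹ * P * (Mᴴ * M⁻¹ᴴ)
          - (z + star z) • (M⁻¹ * P * M⁻¹ᴴ) := by
          rw [h3]
          simp only [Matrix.mul_sub, Matrix.mul_add, Matrix.sub_mul, Matrix.add_mul,
            Matrix.mul_smul, Matrix.smul_mul, Matrix.mul_assoc]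
      _ = _ := by rw [h1, h2, Matrix.one_mul, Matrix.mul_one]
  have h5 : B * Dᴴ = -(P * Cᴴ) := eq_neg_of_add_eq_zero_left h.cross
  have h6 : D * Bᴴ = -(C * P) := eq_neg_of_add_eq_zero_left h.cross_conjTranspose
  have h7 : (C * M⁻¹ * B + D) * (C * M⁻¹ * B + D)ᴴ =
      C * (M⁻¹ * (B * Bᴴ) * M⁻¹ᴴ) * Cᴴ + C * M⁻¹ * (B * Dᴴ) + D * Bᴴ * M⁻¹ᴴ * Cᴴ + D * Dᴴ := by
    simp only [Matrix.conjTranspose_add, Matrix.conjTranspose_mul, Matrix.mul_add, Matrix.add_mul,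
      Matrix.mul_assoc]
    abel
  rw [h7, h4, h5, h6, h.unitary]
  simp only [Matrix.conjTranspose_mul, Matrix.mul_add, Matrix.add_mul, Matrix.mul_sub,
    Matrix.sub_mul, Matrix.mul_neg, Matrix.neg_mul, Matrix.mul_smul, Matrix.smul_mul,
    Matrix.mul_assoc]
  abel

/-- Contractive matrices have entries of modulus at most `1`. -/
lemma norm_apply_le_one {ι ι' : Type*} [DecidableEq ι] [Fintype ι'] {M : Matrix ι ι' ℂ} (h : (1 - M * Mᴴ).PosSemidef) (i : ι) (j : ι') :
    ‖M i j‖ ≤ 1 := by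
  have h1 := h.diag_nonneg (i := i)
  have h2 : (1 - M * Mᴴ : Matrix ι ι ℂ) i i = ((1 - ∑ j, ‖M i j‖ ^ 2 : ℝ) : ℂ) := by
    simp [Matrix.mul_apply, Complex.mul_conj, Complex.normSq_eq_norm_sq]
  rw [h2, Complex.zero_le_real] at h1
  have h3 : ‖M i j‖ ^ 2 ≤ ∑ j, ‖M i j‖ ^ 2 :=
    Finset.single_le_sum (f := fun j => ‖M i j‖ ^ 2) (fun j _ => sq_nonneg _) (Finset.mem_univ j)
  exact (sq_le_one_iff₀ (norm_nonneg _)).1 (by linarith)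

lemma tendsto_ofReal_mul_I_cofinite :
    Tendsto (fun ω : ℝ => (ω : ℂ) * Complex.I) cofinite cofinite :=
  Function.Injective.tendsto_cofinite fun a b h => by
    simpa [Complex.I_ne_zero] using h

/-- A rational matrix that is unitary at almost all points of the imaginary axis has no pole on the
axis and is unitary everywhere on it. -/
lemma isUnitaryOnAxis_of_eventually {W : RatMatrix ι ι}
    (h : ∀ᶠ ω : ℝ in cofinite,
      evalAt W (ω * Complex.I) * (evalAt W (ω * Complex.I))ᴴ = 1) : IsUnitaryOnAxis W := by
  intro ω
  refine regularAt_and_evalAt_mem_of_frequently (T := {M : Matrix ι ι ℂ | M * Mᴴ = 1})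
    (isClosed_eq (by fun_prop) continuous_const) (fun M hM => ?_) ?_
  · refine norm_apply_le_one ?_
    rw [Set.mem_ofPred_eq] at hM
    rw [hM, sub_self]
    exact Matrix.PosSemidef.zero
  · have h1 : ∀ᶠ x : ℝ in 𝓝[≠] ω, RegularAt W (x * Complex.I) ∧
        evalAt W (x * Complex.I) * (evalAt W (x * Complex.I))ᴴ = 1 :=
      nhdsNE_le_cofinite ω ((tendsto_ofReal_mul_I_cofinite.eventually (eventually_regularAt W)).and h)
    have h2 : Tendsto (fun x : ℝ => (x : ℂ) * Complex.I) (𝓝[≠] ω) (𝓝 (ω * Complex.I)) :=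
      (Continuous.tendsto (by fun_prop) ω).mono_left nhdsWithin_le_nhds
    exact h2.frequently h1.frequently

/-- Removal of the singularities in the definition of a Schur function. -/
lemma isSchur_of_eventually {W : RatMatrix ι ι'}
    (h : ∀ᶠ z in cofinite, 0 < z.re → (1 - evalAt W z * (evalAt W z)ᴴ).PosSemidef) :
    IsSchur W := by
  intro z hz
  have hcl : IsClosed {M : Matrix ι ι' ℂ | (1 - M * Mᴴ).PosSemidef} :=
    isClosed_posSemidef.preimage (by fun_prop : Continuous fun M : Matrix ι ι' ℂ => 1 - M * Mᴴ)
  refine regularAt_and_evalAt_mem_of_frequently hcl (fun M hM => norm_apply_le_one hM) ?_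
  have h1 : ∀ᶠ w in 𝓝[≠] z, RegularAt W w ∧
      (0 < w.re → (1 - evalAt W w * (evalAt W w)ᴴ).PosSemidef) :=
    nhdsNE_le_cofinite z ((eventually_regularAt W).and h)
  have h2 : ∀ᶠ w in 𝓝[≠] z, 0 < w.re :=
    nhdsWithin_le_nhds ((isOpen_lt continuous_const Complex.continuous_re).mem_nhds hz)
  have h3 := (h1.and h2).mono fun w hw => (⟨hw.1.1, hw.1.2 hw.2⟩ :
    RegularAt W w ∧ (1 - evalAt W w * (evalAt W w)ᴴ).PosSemidef)
  exact h3.frequently.filter_mono nhdsWithin_le_nhds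

lemma IsLossless.isUnitaryOnAxis [DecidableEq n] (h : IsLossless A B C D P) :
    IsUnitaryOnAxis (transfer A B C D) := by
  refine isUnitaryOnAxis_of_eventually ?_
  filter_upwards [tendsto_ofReal_mul_I_cofinite.eventually (eventually_isUnit_scalar_sub A)]
    with ω hω
  have h1 := h.one_sub_evalAt_mul hω
  have h2 : (ω : ℂ) * Complex.I + star ((ω : ℂ) * Complex.I) = 0 := by
    apply Complex.ext <;> simp
  rw [h2, zero_smul, sub_eq_zero] at h1
  exact h1.symm

lemma IsLossless.isSchur [DecidableEq n] (h : IsLossless A B C D P) (hP : P.PosSemidef) :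
    IsSchur (transfer A B C D) := by
  refine isSchur_of_eventually ?_
  filter_upwards [eventually_isUnit_scalar_sub A] with z hz hre
  rw [h.one_sub_evalAt_mul hz]
  refine (hP.mul_mul_conjTranspose_same _).smul ?_
  rw [Complex.le_def]
  constructor <;> simp [hre.le]

lemma IsLossless.isInner [DecidableEq n] (h : IsLossless A B C D P) (hP : P.PosSemidef) :
    IsInner (transfer A B C D) := ⟨h.isSchur hP, h.isUnitaryOnAxis⟩

/-- Series connections of lossless realizations are lossless. -/
lemma IsLossless.series (h : IsLossless A B C D P) {A' : Matrix m m ℂ} {B' : Matrix m ι ℂ}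
    {C' : Matrix ι m ℂ} {D' : Matrix ι ι ℂ} {P' : Matrix m m ℂ} (h' : IsLossless A' B' C' D' P') :
    IsLossless (Matrix.fromBlocks A (B * C') 0 A') (Matrix.fromRows (B * D') B')
      (Matrix.fromCols C (D * C')) (D * D') (Matrix.fromBlocks P 0 0 P') where
  isHermitian := h.isHermitian.fromBlocks (Matrix.conjTranspose_zero) h'.isHermitian
  lyapunov := by
    have e1 : A * P + P * Aᴴ + B * D' * (B * D')ᴴ = 0 := by
      rw [Matrix.conjTranspose_mul, Matrix.mul_assoc B, ← Matrix.mul_assoc D', h'.unitary,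
        Matrix.one_mul, h.lyapunov]
    have e2 : B * C' * P' + B * D' * B'ᴴ = 0 := by
      rw [Matrix.mul_assoc, Matrix.mul_assoc, ← Matrix.mul_add, add_comm, h'.cross_conjTranspose,
        Matrix.mul_zero]
    have e3 : P' * (B * C')ᴴ + B' * (B * D')ᴴ = 0 := by
      have := congrArg Matrix.conjTranspose e2
      rwa [Matrix.conjTranspose_add, Matrix.conjTranspose_mul (B * C'), h'.isHermitian.eq,
        Matrix.conjTranspose_mul (B * D'), Matrix.conjTranspose_conjTranspose,
        Matrix.conjTranspose_zero] at this
    rw [Matrix.fromBlocks_conjTranspose, Matrix.fromBlocks_multiply, Matrix.fromBlocks_multiply,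
      Matrix.conjTranspose_fromRows_eq_fromCols_conjTranspose, Matrix.fromRows_mul_fromCols,
      Matrix.fromBlocks_add, Matrix.fromBlocks_add, ← Matrix.fromBlocks_zero]
    simp only [Matrix.mul_zero, Matrix.zero_mul, Matrix.conjTranspose_zero, add_zero, zero_add, e1,
      e2, e3, h'.lyapunov]
  cross := by
    have e1 : B * D' * (D * D')ᴴ + P * Cᴴ = 0 := by
      rw [Matrix.conjTranspose_mul, Matrix.mul_assoc B, ← Matrix.mul_assoc D', h'.unitary,
        Matrix.one_mul, h.cross]
    have e2 : B' * (D * D')ᴴ + P' * (D * C')ᴴ = 0 := by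
      rw [Matrix.conjTranspose_mul, Matrix.conjTranspose_mul, ← Matrix.mul_assoc,
        ← Matrix.mul_assoc, ← Matrix.add_mul, h'.cross, Matrix.zero_mul]
    rw [Matrix.conjTranspose_fromCols_eq_fromRows_conjTranspose, Matrix.fromRows_mul,
      Matrix.fromBlocks_mul_fromRows]
    simp only [Matrix.zero_mul, add_zero, zero_add]
    ext (i | i) j
    · exact congrFun (congrFun e1 i) j
    · exact congrFun (congrFun e2 i) j
  unitary := by
    rw [Matrix.conjTranspose_mul, Matrix.mul_assoc, ← Matrix.mul_assoc D', h'.unitary,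
      Matrix.one_mul, h.unitary]

/-- Adjoining identity channels keeps a realization lossless. -/
lemma IsLossless.fromBlocks_one [DecidableEq ι'] (h : IsLossless A B C D P) :
    IsLossless A (Matrix.fromCols B (0 : Matrix n ι' ℂ)) (Matrix.fromRows C 0)
      (Matrix.fromBlocks D 0 0 1) P where
  isHermitian := h.isHermitian
  lyapunov := by
    rw [Matrix.conjTranspose_fromCols_eq_fromRows_conjTranspose, Matrix.fromCols_mul_fromRows]
    simp [h.lyapunov]
  cross := by
    rw [Matrix.fromBlocks_conjTranspose, Matrix.conjTranspose_fromRows_eq_fromCols_conjTranspose,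
      Matrix.mul_fromCols, Matrix.fromCols_mul_fromBlocks]
    ext i (j | j)
    · simpa using congrFun (congrFun h.cross i) j
    · simp
  unitary := by
    rw [Matrix.fromBlocks_conjTranspose, Matrix.fromBlocks_multiply, ← Matrix.fromBlocks_one]
    simp [h.unitary]

lemma transfer_fromBlocks_one {n ι ι' : Type*} [Fintype n] [DecidableEq n] [DecidableEq ι'] (A : Matrix n n ℂ) (B : Matrix n ι ℂ) (C : Matrix ι n ℂ)
    (D : Matrix ι ι ℂ) :
    transfer A (Matrix.fromCols B (0 : Matrix n ι' ℂ)) (Matrix.fromRows C 0)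
      (Matrix.fromBlocks D 0 0 (1 : Matrix ι' ι' ℂ)) =
        Matrix.fromBlocks (transfer A B C D) 0 0 1 := by
  simp only [transfer_eq, const_fromBlocks, const_fromCols, const_fromRows, const_zero, const_one,
    Matrix.fromRows_mul, Matrix.mul_fromCols, Matrix.zero_mul]
  ext (i | i) (j | j) <;> simp

/-- A stable realization that is lossless with respect to a positive definite matrix is
controllable and observable. -/
lemma IsLossless.isControllable_and_isObservable [DecidableEq n] (h : IsLossless A B C D P) (hA : IsStable A)
    (hP : P.PosDef) : IsControllable A B ∧ IsObservable A C := by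
  have h1 := hA.isObservable_conjTranspose h.lyapunov hP
  refine ⟨by simpa using h1.isControllable_conjTranspose, ?_⟩
  refine isObservable_of_forall_eigenvector fun z v hv hC => ?_
  have hd := (Matrix.isUnit_iff_isUnit_det _).1 hP.isUnit
  -- the dual eigenvector is `P⁻¹ v`
  have hw : P *ᵥ (P⁻¹ *ᵥ v) = v := by
    rw [Matrix.mulVec_mulVec, Matrix.mul_nonsing_inv _ hd, Matrix.one_mulVec]
  set w := P⁻¹ *ᵥ v
  have hBw : Bᴴ *ᵥ w = 0 := by
    have h2 : (D * Bᴴ + C * P) *ᵥ w = 0 := by rw [h.cross_conjTranspose, Matrix.zero_mulVec]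
    rw [Matrix.add_mulVec, ← Matrix.mulVec_mulVec, ← Matrix.mulVec_mulVec, hw, hC, add_zero] at h2
    have h3 := congrArg (Dᴴ *ᵥ ·) h2
    simpa [Matrix.mulVec_mulVec, mul_eq_one_comm.1 h.unitary, ← Matrix.mul_assoc] using h3
  have hAw : Aᴴ *ᵥ w = (-z) • w := by
    have h2 : (A * P + P * Aᴴ + B * Bᴴ) *ᵥ w = 0 := by rw [h.lyapunov, Matrix.zero_mulVec]
    rw [Matrix.add_mulVec, Matrix.add_mulVec, ← Matrix.mulVec_mulVec, ← Matrix.mulVec_mulVec,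
      ← Matrix.mulVec_mulVec, hw, hBw, hv, Matrix.mulVec_zero, add_zero] at h2
    have h3 := congrArg (P⁻¹ *ᵥ ·) (eq_neg_of_add_eq_zero_right h2)
    simpa [Matrix.mulVec_mulVec, Matrix.nonsing_inv_mul _ hd, ← Matrix.mul_assoc,
      Matrix.mulVec_smul, Matrix.mulVec_neg, w] using h3
  rw [← hw, h1.eq_zero hAw hBw, Matrix.mulVec_zero]

lemma isStable_fromBlocks [DecidableEq n] [DecidableEq m] {A' : Matrix m m ℂ} (hA : IsStable A) (hA' : IsStable A')
    (M : Matrix n m ℂ) : IsStable (Matrix.fromBlocks A M 0 A') := by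
  intro z hz
  have : Matrix.scalar (n ⊕ m) z - Matrix.fromBlocks A M 0 A' =
      Matrix.fromBlocks (Matrix.scalar n z - A) (-M) 0 (Matrix.scalar m z - A') := by
    ext (i | i) (j | j) <;> simp [Matrix.diagonal_apply]
  rw [this, Matrix.isUnit_iff_isUnit_det, Matrix.det_fromBlocks_zero₂₁]
  exact ((Matrix.isUnit_iff_isUnit_det _).1 (hA z hz)).mul
    ((Matrix.isUnit_iff_isUnit_det _).1 (hA' z hz))

end Lossless

/-! ### The square roots of `I - D Dᴴ` and `I - Dᴴ D` -/

section SquareRoots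

/-- A Sylvester equation with positive definite coefficients has only the zero solution. -/
lemma eq_zero_of_posDef_sylvester {m k : Type*} [Fintype m] [Fintype k] {E : Matrix m m ℂ}
    {F : Matrix k k ℂ} (hE : E.PosDef) (hF : F.PosDef) {M : Matrix k m ℂ}
    (h : F * M + M * E = 0) : M = 0 := by
  -- the two traces are nonnegative and sum to zero
  have h1 : (Mᴴ * F * M).trace + (M * E * Mᴴ).trace = 0 := by
    rw [Matrix.trace_mul_cycle M E Mᴴ, ← Matrix.trace_add, Matrix.mul_assoc, Matrix.mul_assoc,
      ← Matrix.mul_add, h, Matrix.mul_zero, Matrix.trace_zero]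
  have h2 := (hF.posSemidef.conjTranspose_mul_mul_same M).trace_nonneg
  have h3 := (hE.posSemidef.mul_mul_conjTranspose_same M).trace_nonneg
  have h4 : (Mᴴ * F * M).trace = 0 := le_antisymm (by
    rw [eq_neg_of_add_eq_zero_left h1]; exact neg_nonpos.2 h3) h2
  have h5 : Mᴴ * F * M = 0 :=
    (hF.posSemidef.conjTranspose_mul_mul_same M).trace_eq_zero_iff.1 h4
  ext i j
  by_contra hij
  have hcol : M.col j ≠ 0 := fun h0 => hij (congrFun h0 i)
  have h6 := hF.dotProduct_mulVec_pos hcol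
  have h7 : star (M.col j) ⬝ᵥ F *ᵥ M.col j = (Mᴴ * F * M) j j := by
    rw [Matrix.mul_assoc, Matrix.mul_apply]
    rfl
  rw [h7, h5] at h6
  exact lt_irrefl _ h6

variable {p : ℕ} {D : Matrix (Fin p) (Fin p) ℂ}

lemma posDef_sqrt {M : Matrix (Fin p) (Fin p) ℂ} (hM : M.PosDef) :
    (CFC.sqrt M).PosDef ∧ CFC.sqrt M * CFC.sqrt M = M := by
  have h0 : 0 ≤ M := Matrix.nonneg_iff_posSemidef.2 hM.posSemidef
  have h1 : CFC.sqrt M * CFC.sqrt M = M := CFC.sqrt_mul_sqrt_self M h0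
  have h2 : (CFC.sqrt M).PosSemidef := Matrix.nonneg_iff_posSemidef.1 (CFC.sqrt_nonneg M)
  refine ⟨h2.posDef_iff_isUnit.2 ?_, h1⟩
  have h3 := hM.isUnit
  rw [← h1] at h3
  exact isUnit_of_mul_isUnit_left h3

lemma transpose_conjTranspose_of_symm {m : Type*} {M : Matrix m m ℂ} (h : Mᵀ = M) :
    Mᴴᵀ = Mᴴ := by
  conv_rhs => rw [← h]
  rfl

lemma one_sub_transpose (hD : Dᵀ = D) : (1 - D * Dᴴ)ᵀ = 1 - Dᴴ * D := by
  rw [Matrix.transpose_sub, Matrix.transpose_one, Matrix.transpose_mul, hD]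
  rw [transpose_conjTranspose_of_symm hD]

lemma D12_eq_transpose (hD : Dᵀ = D) (h : (1 - D * Dᴴ).PosDef) : D12 D = (D21 D)ᵀ := by
  have h1 := posDef_sqrt h
  refine CFC.sqrt_unique ?_ (Matrix.nonneg_iff_posSemidef.2 h1.1.posSemidef.transpose)
  rw [← Matrix.transpose_mul, D21, h1.2, one_sub_transpose hD]

/-- `Dᴴ` intertwines the two square roots. -/
lemma conjTranspose_mul_D21 (hD : Dᵀ = D) (h : (1 - D * Dᴴ).PosDef) :
    Dᴴ * D21 D = D12 D * Dᴴ := by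
  have h1 := posDef_sqrt h
  have h2 := posDef_sqrt (one_sub_transpose hD ▸ h.transpose)
  rw [← sub_eq_zero]
  refine eq_zero_of_posDef_sylvester h1.1 h2.1 ?_
  have e1 : D21 D * D21 D = 1 - D * Dᴴ := h1.2
  have e2 : D12 D * D12 D = 1 - Dᴴ * D := h2.2
  change D12 D * (Dᴴ * D21 D - D12 D * Dᴴ) + (Dᴴ * D21 D - D12 D * Dᴴ) * D21 D = 0
  calc D12 D * (Dᴴ * D21 D - D12 D * Dᴴ) + (Dᴴ * D21 D - D12 D * Dᴴ) * D21 D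
      = Dᴴ * (D21 D * D21 D) - (D12 D * D12 D) * Dᴴ := by noncomm_ring
    _ = 0 := by rw [e1, e2]; noncomm_ring

end SquareRoots

/-! ### Further identities for transfer functions -/

section TransferIdentities

variable {n ι κ : Type*} [Fintype n] [DecidableEq n]

lemma transfer_transpose (A : Matrix n n ℂ) (B : Matrix n κ ℂ) (C : Matrix ι n ℂ)
    (D : Matrix ι κ ℂ) : (transfer A B C D)ᵀ = transfer Aᵀ Cᵀ Bᵀ Dᵀ := by
  have : (pencil A)ᵀ = pencil Aᵀ := by
    rw [pencil, Matrix.transpose_sub, const_transpose]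
    congr 1
    simp
  rw [transfer_eq, transfer_eq, Matrix.transpose_add, Matrix.transpose_mul, Matrix.transpose_mul,
    Matrix.transpose_nonsing_inv, this]
  simp only [const_transpose, Matrix.mul_assoc]

lemma transfer_fromBlocks {ι' κ' : Type*} (A : Matrix n n ℂ) (B₁ : Matrix n κ ℂ)
    (B₂ : Matrix n κ' ℂ) (C₁ : Matrix ι n ℂ) (C₂ : Matrix ι' n ℂ) (D₁₁ : Matrix ι κ ℂ)
    (D₁₂ : Matrix ι κ' ℂ) (D₂₁ : Matrix ι' κ ℂ) (D₂₂ : Matrix ι' κ' ℂ) :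
    transfer A (Matrix.fromCols B₁ B₂) (Matrix.fromRows C₁ C₂)
        (Matrix.fromBlocks D₁₁ D₁₂ D₂₁ D₂₂) =
      Matrix.fromBlocks (transfer A B₁ C₁ D₁₁) (transfer A B₂ C₁ D₁₂) (transfer A B₁ C₂ D₂₁)
        (transfer A B₂ C₂ D₂₂) := by
  simp only [transfer_eq, const_fromBlocks, const_fromCols, const_fromRows,
    Matrix.fromRows_mul, Matrix.mul_fromCols]
  ext (i | i) (j | j) <;> simp

variable [Fintype ι] [DecidableEq ι]

/-- Division of transfer functions that share `A`, `C` and the invertible value `E` at infinity. -/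
lemma transfer_mul_quotient {A : Matrix n n ℂ} {B : Matrix n ι ℂ} {C : Matrix ι n ℂ}
    {E : Matrix ι ι ℂ} (hE : IsUnit E) (M : Matrix n ι ℂ) :
    transfer A B C E * transfer (A - B * (E⁻¹ * C)) M (E⁻¹ * C) 1 = transfer A (B + M) C E := by
  set A' := A - B * (E⁻¹ * C) with hA'
  have hE1 : E * E⁻¹ = 1 := Matrix.mul_nonsing_inv _ ((Matrix.isUnit_iff_isUnit_det _).1 hE)
  have h1 : const B * const (E⁻¹ * C) = pencil A' - pencil A := by
    rw [← const_mul, pencil, pencil, hA', const_sub]; abel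
  have h2 : (pencil A)⁻¹ * (const B * const (E⁻¹ * C)) * (pencil A')⁻¹ =
      (pencil A)⁻¹ - (pencil A')⁻¹ := by
    rw [h1, Matrix.mul_sub, Matrix.sub_mul, inv_mul_pencil, Matrix.one_mul, Matrix.mul_assoc,
      pencil_mul_inv, Matrix.mul_one]
  have h3 : const E * const (E⁻¹ * C) = const C := by
    rw [← const_mul, ← Matrix.mul_assoc, hE1, Matrix.one_mul]
  calc transfer A B C E * transfer A' M (E⁻¹ * C) 1
      = const C * ((pencil A)⁻¹ * (const B * const (E⁻¹ * C)) * (pencil A')⁻¹) * const M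
        + (const E * const (E⁻¹ * C)) * (pencil A')⁻¹ * const M
        + const C * (pencil A)⁻¹ * const B + const E := by
        rw [transfer_eq, transfer_eq, const_one]
        simp only [Matrix.mul_add, Matrix.add_mul, Matrix.mul_assoc, Matrix.mul_one]
        abel
    _ = transfer A (B + M) C E := by
        rw [h2, h3, transfer_eq, const_add]
        simp only [Matrix.mul_add, Matrix.mul_sub, Matrix.sub_mul, Matrix.mul_assoc]
        abel

lemma isUnit_transfer (A : Matrix n n ℂ) (B : Matrix n ι ℂ) (C : Matrix ι n ℂ)
    {E : Matrix ι ι ℂ} (hE : IsUnit E) : IsUnit (transfer A B C E) := by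
  have hE1 : E * E⁻¹ = 1 := Matrix.mul_nonsing_inv _ ((Matrix.isUnit_iff_isUnit_det _).1 hE)
  have h := transfer_mul_quotient (A := A) (B := B) (C := C) hE (-B)
  have h0 : transfer A (B + -B) C E = const E := by
    rw [transfer_eq, add_neg_cancel, const_zero, Matrix.mul_zero, zero_add]
  rw [h0] at h
  refine IsUnit.of_mul_eq_one (transfer (A - B * (E⁻¹ * C)) (-B) (E⁻¹ * C) 1 * const E⁻¹) ?_
  rw [← Matrix.mul_assoc, h, ← const_mul, hE1, const_one]

end TransferIdentities

/-! ### The Riccati equation -/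

section RiccatiEquation

variable {n κ : Type*} [Fintype n] [DecidableEq n] [Fintype κ]

/-- Hermitian solutions of the Riccati equation are invertible: the kernel of `P` is an
unobservable subspace of the dual pair. -/
lemma isUnit_of_riccati {a K P : Matrix n n ℂ} {b : Matrix n κ ℂ} (hP : P.IsHermitian)
    (h : P * K * P + a * P + P * aᴴ + b * bᴴ = 0) (hab : IsControllable a b) : IsUnit P := by
  have key : LinearMap.ker P.mulVecLin = ⊥ := by
    have hker : ∀ v, P *ᵥ v = 0 → P *ᵥ (aᴴ *ᵥ v) + b *ᵥ (bᴴ *ᵥ v) = 0 := fun v hv => by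
      have h1 : (P * K * P + a * P + P * aᴴ + b * bᴴ) *ᵥ v = 0 := by rw [h, Matrix.zero_mulVec]
      simpa only [Matrix.add_mulVec, ← Matrix.mulVec_mulVec, hv, Matrix.mulVec_zero, zero_add]
        using h1
    have hb : ∀ v, P *ᵥ v = 0 → bᴴ *ᵥ v = 0 := fun v hv => by
      have h1 := congrArg (star v ⬝ᵥ ·) (hker v hv)
      simp only [dotProduct_add, dotProduct_zero] at h1
      rw [star_dotProduct_mulVec P, hP.eq, hv, star_zero, zero_dotProduct, zero_add,
        star_dotProduct_mulVec b] at h1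
      exact dotProduct_star_self_eq_zero.1 h1
    refine hab.isObservable_conjTranspose _ (fun v hv => ?_) fun v hv => hb v hv
    have h1 := hker v hv
    rw [hb v hv, Matrix.mulVec_zero, add_zero] at h1
    exact h1
  rw [Matrix.isUnit_iff_isUnit_det, isUnit_iff_ne_zero]
  intro h0
  obtain ⟨v, hv, hv0⟩ := Matrix.exists_mulVec_eq_zero_iff.2 h0
  exact hv ((Submodule.mem_bot ℂ).1 (key ▸ (show v ∈ LinearMap.ker P.mulVecLin from hv0)))

/-- If `aᵀ = a` and `Kᵀ = L`, then the Riccati equation is preserved by `P ↦ P⁻ᵀ`. -/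
lemma riccati_inv_transpose {a K L P : Matrix n n ℂ} (hu : IsUnit P) (ha : aᵀ = a) (hK : Kᵀ = L)
    (h : P * K * P + a * P + P * aᴴ + L = 0) :
    P⁻¹ᵀ * K * P⁻¹ᵀ + a * P⁻¹ᵀ + P⁻¹ᵀ * aᴴ + L = 0 := by
  have hd := (Matrix.isUnit_iff_isUnit_det _).1 hu
  have haH : aᴴᵀ = aᴴ := transpose_conjTranspose_of_symm ha
  have hL : Lᵀ = K := by rw [← hK, Matrix.transpose_transpose]
  have h1 := congrArg Matrix.transpose h
  simp only [Matrix.transpose_add, Matrix.transpose_mul, Matrix.transpose_zero, ha, hK, haH,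
    hL] at h1
  have e1 : Pᵀ * P⁻¹ᵀ = 1 := by
    rw [← Matrix.transpose_mul, Matrix.nonsing_inv_mul _ hd, Matrix.transpose_one]
  have e2 : P⁻¹ᵀ * Pᵀ = 1 := by
    rw [← Matrix.transpose_mul, Matrix.mul_nonsing_inv _ hd, Matrix.transpose_one]
  have h2 : P⁻¹ᵀ * (Pᵀ * (L * Pᵀ) + Pᵀ * a + aᴴ * Pᵀ + K) * P⁻¹ᵀ = 0 := by rw [h1]; simp
  have h3 : P⁻¹ᵀ * (Pᵀ * (L * Pᵀ) + Pᵀ * a + aᴴ * Pᵀ + K) * P⁻¹ᵀ =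
      (P⁻¹ᵀ * Pᵀ) * L * (Pᵀ * P⁻¹ᵀ) + (P⁻¹ᵀ * Pᵀ) * a * P⁻¹ᵀ + P⁻¹ᵀ * aᴴ * (Pᵀ * P⁻¹ᵀ) +
        P⁻¹ᵀ * K * P⁻¹ᵀ := by noncomm_ring
  rw [h3, e1, e2] at h2
  rw [← h2]
  noncomm_ring

/-- The difference of two solutions of the Riccati equation solves a homogeneous
equation governed by the closed loop matrix `a + P K`. -/
lemma riccati_sub {a K L P P' : Matrix n n ℂ} (hP : P.IsHermitian) (hK : K.IsHermitian)
    (h : P * K * P + a * P + P * aᴴ + L = 0) (h' : P' * K * P' + a * P' + P' * aᴴ + L = 0) :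
    (a + P * K) * (P' - P) + (P' - P) * (a + P * K)ᴴ + (P' - P) * K * (P' - P) = 0 := by
  rw [Matrix.conjTranspose_add, Matrix.conjTranspose_mul, hP.eq, hK.eq]
  calc _ = (P' * K * P' + a * P' + P' * aᴴ + L) - (P * K * P + a * P + P * aᴴ + L) := by
        noncomm_ring
    _ = 0 := by rw [h, h', sub_zero]

end RiccatiEquation

/-! ### The lossless extension -/

section Extension

variable {p n : ℕ} {A : Matrix (Fin n) (Fin n) ℂ} {B : Matrix (Fin n) (Fin p) ℂ}
  {C : Matrix (Fin p) (Fin n) ℂ} {D : Matrix (Fin p) (Fin p) ℂ} {P : Matrix (Fin n) (Fin n) ℂ}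

lemma isUnit_D21 (h : (1 - D * Dᴴ).PosDef) : IsUnit (D21 D) := (posDef_sqrt h).1.isUnit

lemma isUnit_D12 (hD : Dᵀ = D) (h : (1 - D * Dᴴ).PosDef) : IsUnit (D12 D) :=
  (posDef_sqrt (one_sub_transpose hD ▸ h.transpose)).1.isUnit

lemma inv_one_sub_eq (h : (1 - D * Dᴴ).PosDef) :
    (1 - D * Dᴴ)⁻¹ = (D21 D)⁻¹ * (D21 D)⁻¹ := by
  rw [← Matrix.mul_inv_rev, D21, (posDef_sqrt h).2]

lemma conjTranspose_inv_D21 (h : (1 - D * Dᴴ).PosDef) : (D21 D)⁻¹ᴴ = (D21 D)⁻¹ :=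
  (posDef_sqrt h).1.inv.isHermitian

lemma conjTranspose_inv_D12 (hD : Dᵀ = D) (h : (1 - D * Dᴴ).PosDef) :
    (D12 D)⁻¹ᴴ = (D12 D)⁻¹ :=
  (posDef_sqrt (one_sub_transpose hD ▸ h.transpose)).1.inv.isHermitian

lemma inv_D21_mul (hD : Dᵀ = D) (h : (1 - D * Dᴴ).PosDef) :
    (D21 D)⁻¹ * D = D * (D12 D)⁻¹ := by
  have h1 := congrArg Matrix.conjTranspose (conjTranspose_mul_D21 hD h)
  have hE := (posDef_sqrt h).1.isHermitian.eq
  have hF := (posDef_sqrt (one_sub_transpose hD ▸ h.transpose)).1.isHermitian.eq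
  change (D21 D)ᴴ = D21 D at hE
  change (D12 D)ᴴ = D12 D at hF
  rw [Matrix.conjTranspose_mul, Matrix.conjTranspose_mul, hE, hF,
    Matrix.conjTranspose_conjTranspose] at h1
  have e1 := Matrix.nonsing_inv_mul _ ((Matrix.isUnit_iff_isUnit_det _).1 (isUnit_D21 h))
  have e2 := Matrix.mul_nonsing_inv _ ((Matrix.isUnit_iff_isUnit_det _).1 (isUnit_D12 hD h))
  calc (D21 D)⁻¹ * D = (D21 D)⁻¹ * (D * D12 D) * (D12 D)⁻¹ := by
        rw [Matrix.mul_assoc, Matrix.mul_assoc D, e2, Matrix.mul_one]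
    _ = D * (D12 D)⁻¹ := by rw [← h1, ← Matrix.mul_assoc, e1, Matrix.one_mul]

/-- The identity `(I - Dᴴ D)⁻¹ = I + Dᴴ (I - D Dᴴ)⁻¹ D`, in terms of the square roots. -/
lemma inv_D12_mul_self (hD : Dᵀ = D) (h : (1 - D * Dᴴ).PosDef) :
    (D12 D)⁻¹ * (D12 D)⁻¹ = 1 + Dᴴ * ((D21 D)⁻¹ * ((D21 D)⁻¹ * D)) := by
  have hF : D12 D * D12 D = 1 - Dᴴ * D :=
    (posDef_sqrt (one_sub_transpose hD ▸ h.transpose)).2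
  have e2 := Matrix.mul_nonsing_inv _ ((Matrix.isUnit_iff_isUnit_det _).1 (isUnit_D12 hD h))
  have h1 : Dᴴ * ((D21 D)⁻¹ * ((D21 D)⁻¹ * D)) = Dᴴ * D * ((D12 D)⁻¹ * (D12 D)⁻¹) := by
    rw [inv_D21_mul hD h, ← Matrix.mul_assoc (D21 D)⁻¹, inv_D21_mul hD h]
    simp only [Matrix.mul_assoc]
  have h2 : Dᴴ * D = 1 - D12 D * D12 D := by rw [hF, sub_sub_cancel]
  rw [h1, h2, Matrix.sub_mul, Matrix.one_mul]
  have h3 : D12 D * D12 D * ((D12 D)⁻¹ * (D12 D)⁻¹) = 1 := by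
    rw [Matrix.mul_assoc, ← Matrix.mul_assoc (D12 D) (D12 D)⁻¹, e2, Matrix.one_mul, e2]
  rw [h3]
  abel

lemma conjTranspose_hatC (h : (1 - D * Dᴴ).PosDef) : (hatC C D)ᴴ = Cᴴ * (D21 D)⁻¹ := by
  rw [hatC, Matrix.conjTranspose_mul, conjTranspose_inv_D21 h]

lemma isControllable_hat (h : (1 - D * Dᴴ).PosDef) (hD : Dᵀ = D) (hAB : IsControllable A B) :
    IsControllable (hatA A B C D) (hatB B D) := by
  have h1 := (hAB.add_mul (Dᴴ * (1 - D * Dᴴ)⁻¹ * C)).mul_isUnit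
    (M := (D12 D)⁻¹) ((Matrix.isUnit_nonsing_inv_iff).2 (isUnit_D12 hD h))
  rw [← Matrix.mul_assoc, ← Matrix.mul_assoc] at h1
  exact h1

lemma hatA_transpose (hA : Aᵀ = A) (hBC : Bᵀ = C) (hD : Dᵀ = D) (h : (1 - D * Dᴴ).PosDef) :
    (hatA A B C D)ᵀ = hatA A B C D := by
  have hDH : Dᴴᵀ = Dᴴ := transpose_conjTranspose_of_symm hD
  have hE : (D21 D)⁻¹ᵀ = (D12 D)⁻¹ := by
    rw [Matrix.transpose_nonsing_inv, D12_eq_transpose hD h]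
  have h1 : (D12 D)⁻¹ * Dᴴ = Dᴴ * (D21 D)⁻¹ := by
    have := congrArg Matrix.conjTranspose (inv_D21_mul hD h)
    rw [Matrix.conjTranspose_mul, Matrix.conjTranspose_mul, conjTranspose_inv_D21 h,
      conjTranspose_inv_D12 hD h] at this
    exact this.symm
  subst hBC
  rw [hatA, inv_one_sub_eq h]
  simp only [Matrix.transpose_add, Matrix.transpose_mul, Matrix.transpose_transpose, hA, hDH, hE]
  simp only [Matrix.mul_assoc]
  rw [← Matrix.mul_assoc (D12 D)⁻¹ Dᴴ, h1, Matrix.mul_assoc, ← Matrix.mul_assoc (D12 D)⁻¹ Dᴴ, h1,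
    Matrix.mul_assoc]

lemma hatC_transpose (hBC : Bᵀ = C) (hD : Dᵀ = D) (h : (1 - D * Dᴴ).PosDef) :
    ((hatC C D)ᴴ * hatC C D)ᵀ = hatB B D * (hatB B D)ᴴ := by
  have hE : (D21 D)⁻¹ᵀ = (D12 D)⁻¹ := by
    rw [Matrix.transpose_nonsing_inv, D12_eq_transpose hD h]
  have hC : Bᵀᴴᵀ = Bᴴ := rfl
  rw [conjTranspose_hatC h, hatC, hatB, Matrix.conjTranspose_mul, conjTranspose_inv_D12 hD h]
  simp only [Matrix.transpose_mul, hE, ← hBC, hC, Matrix.transpose_transpose, Matrix.mul_assoc]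

/-- The extension is lossless with respect to the solution of the Riccati equation. -/
lemma isLossless_extension (hD : Dᵀ = D) (h : (1 - D * Dᴴ).PosDef) (hP : P.IsHermitian)
    (hu : IsUnit P) (hRic : riccati A B C D P = 0) :
    IsLossless A (Matrix.fromCols (B1 B C D P) B) (Matrix.fromRows (C1 B C D P) C)
      (Matrix.fromBlocks (-Dᴴ) (D12 D) (D21 D) D) P := by
  have hE : (D21 D)ᴴ = D21 D := (posDef_sqrt h).1.isHermitian.eq
  have hF : (D12 D)ᴴ = D12 D :=
    (posDef_sqrt (one_sub_transpose hD ▸ h.transpose)).1.isHermitian.eq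
  have hEE : D21 D * D21 D = 1 - D * Dᴴ := (posDef_sqrt h).2
  have hFF : D12 D * D12 D = 1 - Dᴴ * D :=
    (posDef_sqrt (one_sub_transpose hD ▸ h.transpose)).2
  have hDE := conjTranspose_mul_D21 hD h
  have hED : D21 D * D = D * D12 D := by
    have := congrArg Matrix.conjTranspose hDE
    rwa [Matrix.conjTranspose_mul, Matrix.conjTranspose_mul, hE, hF,
      Matrix.conjTranspose_conjTranspose] at this
  have hd := (Matrix.isUnit_iff_isUnit_det _).1 hu
  have hEu := (Matrix.isUnit_iff_isUnit_det _).1 (isUnit_D21 h)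
  have hFu := (Matrix.isUnit_iff_isUnit_det _).1 (isUnit_D12 hD h)
  have hB1 : (B1 B C D P)ᴴ = -((D21 D)⁻¹ * (C * P + D * Bᴴ)) := by
    simp only [B1, Matrix.conjTranspose_neg, Matrix.conjTranspose_mul, Matrix.conjTranspose_add,
      conjTranspose_inv_D21 h, Matrix.conjTranspose_conjTranspose, hP.eq]
  have hC1 : (C1 B C D P)ᴴ = -((P⁻¹ * B + Cᴴ * D) * (D12 D)⁻¹) := by
    simp only [C1, Matrix.conjTranspose_neg, Matrix.conjTranspose_mul, Matrix.conjTranspose_add,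
      conjTranspose_inv_D12 hD h, Matrix.conjTranspose_conjTranspose, hP.inv.eq]
  refine ⟨hP, ?_, ?_, ?_⟩
  · rw [Matrix.conjTranspose_fromCols_eq_fromRows_conjTranspose, Matrix.fromCols_mul_fromRows, hB1,
      ← hRic, riccati, hatA, inv_one_sub_eq h, conjTranspose_hatC h, hatB, hatC]
    have hff : ∀ M : Matrix (Fin p) (Fin n) ℂ, (D12 D)⁻¹ * ((D12 D)⁻¹ * M) =
        M + Dᴴ * ((D21 D)⁻¹ * ((D21 D)⁻¹ * (D * M))) := fun M => by
      rw [← Matrix.mul_assoc, inv_D12_mul_self hD h, Matrix.add_mul, Matrix.one_mul]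
      simp only [Matrix.mul_assoc]
    simp only [B1, Matrix.conjTranspose_mul, Matrix.conjTranspose_add, conjTranspose_inv_D21 h,
      conjTranspose_inv_D12 hD h, Matrix.conjTranspose_conjTranspose, Matrix.mul_add,
      Matrix.add_mul, Matrix.mul_assoc, Matrix.neg_mul, Matrix.mul_neg, hff]
    abel
  · have e1 : B1 B C D P * (-D) + B * D12 D + P * (C1 B C D P)ᴴ = 0 := by
      have h1 : B * D12 D = B * (D12 D * D12 D) * (D12 D)⁻¹ := by
        rw [Matrix.mul_assoc, Matrix.mul_assoc, Matrix.mul_nonsing_inv _ hFu, Matrix.mul_one]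
      have h2 : P * (P⁻¹ * (B * (D12 D)⁻¹)) = B * (D12 D)⁻¹ := by
        rw [← Matrix.mul_assoc, Matrix.mul_nonsing_inv _ hd, Matrix.one_mul]
      rw [h1, hFF, hC1, B1]
      simp only [Matrix.neg_mul, Matrix.mul_neg, neg_neg, Matrix.add_mul, Matrix.mul_add,
        Matrix.mul_sub, Matrix.sub_mul, Matrix.mul_one, Matrix.mul_assoc, inv_D21_mul hD h, h2,
        neg_add]
      abel
    have e2 : B1 B C D P * D21 D + B * Dᴴ + P * Cᴴ = 0 := by
      rw [B1, Matrix.neg_mul, Matrix.mul_assoc, Matrix.nonsing_inv_mul _ hEu, Matrix.mul_one]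
      abel
    rw [Matrix.fromBlocks_conjTranspose, Matrix.conjTranspose_fromRows_eq_fromCols_conjTranspose,
      Matrix.mul_fromCols, Matrix.fromCols_mul_fromBlocks, Matrix.conjTranspose_neg,
      Matrix.conjTranspose_conjTranspose, hE, hF]
    ext i (j | j)
    · exact congrFun (congrFun e1 i) j
    · exact congrFun (congrFun e2 i) j
  · rw [Matrix.fromBlocks_conjTranspose, Matrix.fromBlocks_multiply, ← Matrix.fromBlocks_one,
      Matrix.conjTranspose_neg, Matrix.conjTranspose_conjTranspose, hE, hF]
    congr 1
    · rw [hFF]; noncomm_ring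
    · rw [Matrix.neg_mul, hDE]; abel
    · rw [Matrix.mul_neg, hED]; abel
    · rw [hEE]; abel

/-- The quotient `Q = S₂₁⁻¹ S₁₂ᵀ` in state space form. -/
lemma quotient_eq_transfer (hA : Aᵀ = A) (hBC : Bᵀ = C) (hD : Dᵀ = D)
    (h : (1 - D * Dᴴ).PosDef) :
    (transfer A (B1 B C D P) C (D21 D))⁻¹ * (transfer A B (C1 B C D P) (D12 D))ᵀ =
      transfer (hatA A B C D + P * ((hatC C D)ᴴ * hatC C D)) (-((P⁻¹ᵀ - P) * (hatC C D)ᴴ))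
        (hatC C D) 1 := by
  have hS := isUnit_transfer A (B1 B C D P) C (isUnit_D21 h)
  have hq := transfer_mul_quotient (A := A) (B := B1 B C D P) (C := C) (isUnit_D21 h)
    (-((P⁻¹ᵀ - P) * (hatC C D)ᴴ))
  have e1 : A - B1 B C D P * ((D21 D)⁻¹ * C) =
      hatA A B C D + P * ((hatC C D)ᴴ * hatC C D) := by
    rw [conjTranspose_hatC h, hatC, hatA, inv_one_sub_eq h, B1]
    simp only [Matrix.neg_mul, Matrix.add_mul, Matrix.mul_assoc, sub_neg_eq_add]
    abel
  have hF : (D12 D)⁻¹ᵀ = (D21 D)⁻¹ := by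
    rw [Matrix.transpose_nonsing_inv, D12_eq_transpose hD h, Matrix.transpose_transpose]
  have hDH : Dᴴᵀ = Dᴴ := transpose_conjTranspose_of_symm hD
  have hBH : Bᴴᵀ = Cᴴ := by rw [← hBC]; rfl
  have e2 : B1 B C D P + -((P⁻¹ᵀ - P) * (hatC C D)ᴴ) = (C1 B C D P)ᵀ := by
    rw [conjTranspose_hatC h, B1, C1]
    simp only [Matrix.transpose_neg, Matrix.transpose_mul, Matrix.transpose_add, hF, hDH, hBH,
      ← hBC, Matrix.transpose_transpose, Matrix.add_mul, Matrix.sub_mul, Matrix.mul_assoc]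
    abel
  rw [e1, e2] at hq
  rw [transfer_transpose, hA, hBC, D12_eq_transpose hD h, Matrix.transpose_transpose, ← hq,
    ← Matrix.mul_assoc, Matrix.nonsing_inv_mul _ ((Matrix.isUnit_iff_isUnit_det _).1 hS),
    Matrix.one_mul]
  rfl

end Extension

/-! ### Splitting off the kernel of the Gramian -/

section Reduction

/-- If `X` is Hermitian and `Z X + X Zᴴ + X K X = 0`, then in an orthonormal eigenbasis of `X` the
matrix `X` is `diag(Y, 0)` with `Y` invertible, and `Z` is block upper triangular. -/
lemma exists_blockTriangular {n : Type*} [Fintype n] [DecidableEq n] {Z X K : Matrix n n ℂ}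
    (hX : X.IsHermitian) (h : Z * X + X * Zᴴ + X * K * X = 0) :
    ∃ (m q : Set n) (_ : Fintype m) (_ : DecidableEq m) (_ : Fintype q) (_ : DecidableEq q)
      (T : Matrix n (m ⊕ q) ℂ) (y : m → ℝ) (Z₁₁ : Matrix m m ℂ) (Z₁₂ : Matrix m q ℂ)
      (Z₂₂ : Matrix q q ℂ), T * Tᴴ = 1 ∧ Tᴴ * T = 1 ∧ (∀ i, y i ≠ 0) ∧
        X * T = T * (Matrix.fromBlocks (Matrix.diagonal fun i => (y i : ℂ)) 0 0 0 :
          Matrix (m ⊕ q) (m ⊕ q) ℂ) ∧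
        Z * T = T * Matrix.fromBlocks Z₁₁ Z₁₂ 0 Z₂₂ ∧ X.rank = Fintype.card m := by
  classical
  let e : {i // hX.eigenvalues i ≠ 0} ⊕ {i // ¬ hX.eigenvalues i ≠ 0} ≃ n :=
    Equiv.sumCompl fun i => hX.eigenvalues i ≠ 0
  let U : Matrix n n ℂ := hX.eigenvectorUnitary
  have hU1 : U * Uᴴ = 1 := Unitary.mul_star_self_of_mem hX.eigenvectorUnitary.2
  have hU2 : Uᴴ * U = 1 := Unitary.star_mul_self_of_mem hX.eigenvectorUnitary.2
  set T := U.submatrix id e with hT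
  have hT1 : T * Tᴴ = 1 := by
    rw [hT, Matrix.conjTranspose_submatrix, Matrix.submatrix_mul_equiv, hU1, Matrix.submatrix_id_id]
  have hT2 : Tᴴ * T = 1 := by
    rw [hT, Matrix.conjTranspose_submatrix, ← Matrix.submatrix_mul _ _ _ _ _ Function.bijective_id,
      hU2, Matrix.submatrix_one_equiv]
  set y : {i // hX.eigenvalues i ≠ 0} → ℝ := fun i => hX.eigenvalues i with hy
  set N : Matrix ({i // hX.eigenvalues i ≠ 0} ⊕ {i // ¬ hX.eigenvalues i ≠ 0})
    ({i // hX.eigenvalues i ≠ 0} ⊕ {i // ¬ hX.eigenvalues i ≠ 0}) ℂ :=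
    Matrix.fromBlocks (Matrix.diagonal fun i => (y i : ℂ)) 0 0 0 with hN
  have hXU : X * U = U * Matrix.diagonal fun i => (hX.eigenvalues i : ℂ) := by
    have := hX.spectral_theorem
    rw [Unitary.conjStarAlgAut_apply] at this
    conv_lhs => rw [this]
    rw [mul_assoc, mul_assoc]
    change U * (_ * (Uᴴ * U)) = _
    rw [hU2, mul_one]
    rfl
  have hND : (Matrix.diagonal fun i => (hX.eigenvalues i : ℂ)).submatrix e e = N := by
    ext (i | i) (j | j)
    · simp [hN, hy, e, Matrix.diagonal_apply, Subtype.ext_iff]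
    · have : (i : n) ≠ j := fun hij => j.2 (hij ▸ i.2)
      simp [hN, e, this]
    · have : (i : n) ≠ j := fun hij => i.2 (hij ▸ j.2)
      simp [hN, e, this]
    · have : hX.eigenvalues i = 0 := not_not.1 i.2
      simp [hN, e, Matrix.diagonal_apply, this]
  have hXT : X * T = T * N := by
    rw [← hND, hT, Matrix.submatrix_mul_equiv, ← hXU]
    rfl
  set Zt := Tᴴ * Z * T with hZt
  set Kt := Tᴴ * K * T with hKt
  have hlyap : Zt * N + N * Ztᴴ + N * Kt * N = 0 := by
    have h1 : Tᴴ * (Z * X + X * Zᴴ + X * K * X) * T = 0 := by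
      rw [h, Matrix.mul_zero, Matrix.zero_mul]
    have hN' : N = Tᴴ * X * T := by
      rw [Matrix.mul_assoc, hXT, ← Matrix.mul_assoc, hT2, Matrix.one_mul]
    have hNn : ∀ M : Matrix n ({i // hX.eigenvalues i ≠ 0} ⊕ {i // ¬ hX.eigenvalues i ≠ 0}) ℂ, T * (Tᴴ * M) = M := fun M => by
      rw [← Matrix.mul_assoc, hT1, Matrix.one_mul]
    rw [← h1, hN', hZt, hKt]
    simp only [Matrix.conjTranspose_mul, Matrix.conjTranspose_conjTranspose, Matrix.mul_add,
      Matrix.add_mul, Matrix.mul_assoc, hNn]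
  have hZ21 : Zt.toBlocks₂₁ = 0 := by
    rw [← Matrix.fromBlocks_toBlocks Zt, ← Matrix.fromBlocks_toBlocks Kt, hN,
      Matrix.fromBlocks_conjTranspose, Matrix.fromBlocks_multiply, Matrix.fromBlocks_multiply,
      Matrix.fromBlocks_multiply, Matrix.fromBlocks_multiply, Matrix.fromBlocks_add,
      Matrix.fromBlocks_add, ← Matrix.fromBlocks_zero, Matrix.fromBlocks_inj] at hlyap
    have h1 := hlyap.2.2.1
    simp only [Matrix.zero_mul, Matrix.mul_zero, add_zero] at h1
    ext i j
    have h2 := congrFun (congrFun h1 i) j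
    rw [Matrix.mul_diagonal] at h2
    exact (mul_eq_zero.1 h2).resolve_right (Complex.ofReal_ne_zero.2 j.2)
  refine ⟨{i | hX.eigenvalues i ≠ 0}, {i | ¬ hX.eigenvalues i ≠ 0}, inferInstance, inferInstance,
    inferInstance, inferInstance, T, y, Zt.toBlocks₁₁, Zt.toBlocks₁₂, Zt.toBlocks₂₂, hT1, hT2,
    fun i => i.2, hXT, ?_, ?_⟩
  · rw [← hZ21, Matrix.fromBlocks_toBlocks, hZt, ← Matrix.mul_assoc, ← Matrix.mul_assoc, hT1,
      Matrix.one_mul]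
  · rw [hX.rank_eq_card_non_zero_eigs]
    exact Fintype.card_congr (Equiv.refl _)

end Reduction

/-! ### Invariant subspaces and characteristic polynomials -/

section Similarity

variable {n m ι : Type*} [Fintype n] [Fintype m]

lemma charpoly_eq_of_mul_eq_mul [DecidableEq n] [DecidableEq m] {A : Matrix n n ℂ} {A' : Matrix m m ℂ} {T : Matrix n m ℂ}
    {T' : Matrix m n ℂ} (h₁ : T * T' = 1) (h₂ : T' * T = 1) (h : A * T = T * A') :
    A.charpoly = A'.charpoly := by
  have hA : A' = T' * A * T := by
    rw [Matrix.mul_assoc, h, ← Matrix.mul_assoc, h₂, Matrix.one_mul]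
  apply RatFunc.algebraMap_injective ℂ
  rw [← det_pencil, ← det_pencil]
  have e₁ : const T * const T' = 1 := by rw [← const_mul, h₁, const_one]
  have e₂ : const T' * const T = 1 := by rw [← const_mul, h₂, const_one]
  rw [← Matrix.det_conj_of_mul_eq_one (N := pencil A) e₂ e₁]
  congr 1
  rw [Matrix.mul_assoc, pencil_mul_const, h, ← const_mul_pencil, ← Matrix.mul_assoc, e₂,
    Matrix.one_mul]

/-- Observability passes to restrictions to invariant subspaces. -/
lemma IsObservable.of_intertwine [DecidableEq m] {A : Matrix n n ℂ} {C : Matrix ι n ℂ} (hC : IsObservable A C)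
    {A' : Matrix m m ℂ} {U : Matrix n m ℂ} (h : A * U = U * A') {U' : Matrix m n ℂ}
    (hU : U' * U = 1) : IsObservable A' (C * U) := by
  refine isObservable_of_forall_eigenvector fun z v hv hCv => ?_
  have h1 : A *ᵥ (U *ᵥ v) = z • (U *ᵥ v) := by
    rw [Matrix.mulVec_mulVec, h, ← Matrix.mulVec_mulVec, hv, Matrix.mulVec_smul]
  have h2 := hC.eq_zero h1 (by rw [Matrix.mulVec_mulVec, hCv])
  have h3 := congrArg (U' *ᵥ ·) h2
  simpa [Matrix.mulVec_mulVec, hU] using h3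

/-- An observable realization that is lossless with respect to an invertible matrix is
controllable. -/
lemma IsLossless.isControllable [DecidableEq n] [Fintype ι] [DecidableEq ι] {A : Matrix n n ℂ} {B : Matrix n ι ℂ} {C : Matrix ι n ℂ}
    {D : Matrix ι ι ℂ} {P : Matrix n n ℂ} (h : IsLossless A B C D P) (hP : IsUnit P)
    (hC : IsObservable A C) : IsControllable A B := by
  have h1 : IsObservable Aᴴ Bᴴ := by
    refine isObservable_of_forall_eigenvector fun z v hv hB => ?_
    have hCP : C *ᵥ (P *ᵥ v) = 0 := by
      have h2 : (D * Bᴴ + C * P) *ᵥ v = 0 := by rw [h.cross_conjTranspose, Matrix.zero_mulVec]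
      simpa only [Matrix.add_mulVec, ← Matrix.mulVec_mulVec, hB, Matrix.mulVec_zero, zero_add]
        using h2
    have hAP : A *ᵥ (P *ᵥ v) = (-z) • (P *ᵥ v) := by
      have h2 : (A * P + P * Aᴴ + B * Bᴴ) *ᵥ v = 0 := by rw [h.lyapunov, Matrix.zero_mulVec]
      simp only [Matrix.add_mulVec, ← Matrix.mulVec_mulVec, hB, Matrix.mulVec_zero, add_zero, hv,
        Matrix.mulVec_smul] at h2
      rw [neg_smul]
      exact eq_neg_of_add_eq_zero_left h2
    exact Matrix.eq_zero_of_mulVec_eq_zero ((Matrix.isUnit_iff_isUnit_det _).1 hP).ne_zero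
      (hC.eq_zero hAP hCP)
  simpa using h1.isControllable_conjTranspose

end Similarity

/-! ### Symmetry of unitary completions -/

section Symmetry

lemma eventually_isUnit_evalAt {ι : Type*} [Fintype ι] [DecidableEq ι] {W : RatMatrix ι ι}
    (hW : IsUnit W) : ∀ᶠ z in cofinite, IsUnit (evalAt W z) := by
  have h1 : W * W⁻¹ = 1 := Matrix.mul_nonsing_inv _ ((Matrix.isUnit_iff_isUnit_det _).1 hW)
  filter_upwards [eventually_regularAt W, eventually_regularAt W⁻¹] with z h2 h3
  refine IsUnit.of_mul_eq_one (evalAt W⁻¹ z) ?_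
  rw [← h2.evalAt_mul h3, h1, evalAt_one]

/-- A completion `[[E, W], [Wᵀ, S]]` of a symmetric `S` that is unitary on the imaginary axis, with
`W` invertible, is symmetric: on the axis both `E` and `Eᵀ` solve `Wᴴ E + Sᴴ Wᵀ = 0`. -/
lemma transpose_eq_of_isUnitaryOnAxis {ι : Type*} [Fintype ι] [DecidableEq ι]
    {E W S : RatMatrix ι ι} (hS : Sᵀ = S) (hW : IsUnit W)
    (h : IsUnitaryOnAxis (Matrix.fromBlocks E W Wᵀ S)) : Eᵀ = E := by
  refine eq_of_frequently_evalAt_eq ?_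
  have h1 := tendsto_ofReal_mul_I_cofinite.eventually (eventually_isUnit_evalAt hW)
  refine tendsto_ofReal_mul_I_cofinite.frequently (h1.mono fun ω hω => ?_).frequently
  have hM := (h ω).2
  set z := (ω : ℂ) * Complex.I
  have hblock : evalAt (Matrix.fromBlocks E W Wᵀ S) z =
      Matrix.fromBlocks (evalAt E z) (evalAt W z) (evalAt W z)ᵀ (evalAt S z) :=
    Matrix.fromBlocks_map ..
  have hs : (evalAt S z)ᵀ = evalAt S z := congrArg (evalAt · z) hS
  rw [hblock] at hM
  have hM' := mul_eq_one_comm.1 hM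
  rw [Matrix.fromBlocks_conjTranspose, Matrix.fromBlocks_multiply, ← Matrix.fromBlocks_one,
    Matrix.fromBlocks_inj] at hM hM'
  have e1 := congrArg Matrix.transpose hM.2.1
  have e2 := congrArg Matrix.conjTranspose hM'.2.1
  rw [Matrix.transpose_add, Matrix.transpose_mul, Matrix.transpose_mul,
    transpose_conjTranspose_of_symm hs, Matrix.transpose_zero] at e1
  rw [Matrix.conjTranspose_add, Matrix.conjTranspose_mul, Matrix.conjTranspose_mul,
    Matrix.conjTranspose_conjTranspose, Matrix.conjTranspose_conjTranspose,
    Matrix.conjTranspose_zero] at e2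
  have e3 : (evalAt W z)ᴴ * (evalAt E z)ᵀ = (evalAt W z)ᴴ * evalAt E z :=
    add_right_cancel (b := (evalAt S z)ᴴ * (evalAt W z)ᵀ) (e1.trans e2.symm)
  have hu : IsUnit (evalAt W z)ᴴ := isUnit_star.2 hω
  exact hu.mul_left_cancel e3

end Symmetry

/-! ### Eigenvalues of the Hamiltonian matrix -/

section Hamiltonian

variable {n m q : Type*} [Fintype n] [DecidableEq n] [Fintype m] [DecidableEq m] [Fintype q]
  [DecidableEq q]

/-- A Hermitian solution of the Riccati equation block triangularizes the Hamiltonian matrix. -/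
lemma charpoly_fromBlocks_of_riccati {a K L P : Matrix n n ℂ}
    (h : P * K * P + a * P + P * aᴴ + L = 0) :
    (Matrix.fromBlocks (-aᴴ) (-K) L a).charpoly =
      (-(aᴴ + K * P)).charpoly * (a + P * K).charpoly := by
  rw [← Matrix.charpoly_fromBlocks_zero₂₁ (M₁₂ := -K)]
  refine charpoly_eq_of_mul_eq_mul (T := Matrix.fromBlocks 1 0 P 1)
    (T' := Matrix.fromBlocks 1 0 (-P) 1) ?_ ?_ ?_
  · rw [Matrix.fromBlocks_multiply, ← Matrix.fromBlocks_one]; simp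
  · rw [Matrix.fromBlocks_multiply, ← Matrix.fromBlocks_one]; simp
  · have hL : L = -(P * K * P + a * P + P * aᴴ) := eq_neg_of_add_eq_zero_right h
    rw [Matrix.fromBlocks_multiply, Matrix.fromBlocks_multiply, hL]
    congr 1 <;> noncomm_ring

/-- The two Riccati solutions `P` and `P⁻ᵀ` have dual closed loop matrices. -/
lemma charpoly_neg_conjTranspose_of_riccati {a K L P : Matrix n n ℂ} (hu : IsUnit P)
    (ha : aᵀ = a) (hK : Kᵀ = L) (h : P * K * P + a * P + P * aᴴ + L = 0) :
    (-(aᴴ + K * P)).charpoly = (a + P⁻¹ᵀ * K).charpoly := by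
  have hd := (Matrix.isUnit_iff_isUnit_det _).1 hu
  rw [← Matrix.charpoly_transpose (a + P⁻¹ᵀ * K), Matrix.transpose_add, Matrix.transpose_mul,
    Matrix.transpose_transpose, ha, hK]
  symm
  refine charpoly_eq_of_mul_eq_mul (Matrix.mul_nonsing_inv _ hd) (Matrix.nonsing_inv_mul _ hd) ?_
  have hL : L = -(P * K * P + a * P + P * aᴴ) := eq_neg_of_add_eq_zero_right h
  rw [Matrix.add_mul, Matrix.mul_assoc, Matrix.nonsing_inv_mul _ hd, hL]
  noncomm_ring

lemma isRoot_charpoly_neg_conjTranspose {Z : Matrix m m ℂ} {z : ℂ}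
    (h : (-Zᴴ).charpoly.IsRoot z) : Z.charpoly.IsRoot (-star z) := by
  rw [Polynomial.IsRoot, Matrix.eval_charpoly] at h ⊢
  have h1 : Matrix.scalar m (-star z) - Z = -(Matrix.scalar m z - -Zᴴ)ᴴ := by
    rw [Matrix.conjTranspose_sub, Matrix.conjTranspose_neg, Matrix.conjTranspose_conjTranspose]
    ext i j
    by_cases hij : i = j
    · subst hij; simp; ring
    · simp [hij]
  rw [h1, Matrix.det_neg, Matrix.det_conjTranspose, h, star_zero, mul_zero]

/-- If `charpoly M = charpoly Z₁₁ * charpoly (-Z₁₁ᴴ) * charpoly Z₂₂ ^ 2`, then an eigenvalue `z`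
of `M` of odd multiplicity is an eigenvalue of `Z₁₁` or of `-Z₁₁ᴴ`. -/
lemma oddEigenvalueCount_le {M : Matrix n n ℂ} {Z₁₁ : Matrix m m ℂ} {Z₂₂ : Matrix q q ℂ}
    (h : M.charpoly = Z₁₁.charpoly * (-Z₁₁ᴴ).charpoly * (Z₂₂.charpoly * Z₂₂.charpoly)) :
    oddEigenvalueCount M ≤ Fintype.card m := by
  have hroot : ∀ z, Odd (M.charpoly.rootMultiplicity z) →
      Z₁₁.charpoly.IsRoot z ∨ Z₁₁.charpoly.IsRoot (-star z) := by
    intro z hz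
    by_contra! hne
    have h0 := M.charpoly_monic.ne_zero
    rw [h] at hz h0
    rw [Polynomial.rootMultiplicity_mul h0, Polynomial.rootMultiplicity_mul (left_ne_zero_of_mul h0),
      Polynomial.rootMultiplicity_mul (right_ne_zero_of_mul h0),
      Polynomial.rootMultiplicity_eq_zero hne.1,
      Polynomial.rootMultiplicity_eq_zero (fun h1 => hne.2 (isRoot_charpoly_neg_conjTranspose h1)),
      zero_add, zero_add] at hz
    exact Nat.not_odd_iff_even.2 ⟨_, rfl⟩ hz
  classical
  -- each such eigenvalue, or its mirror image in the imaginary axis, is an eigenvalue of `Z₁₁`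
  let f : ℂ → ℂ := fun z => if Z₁₁.charpoly.IsRoot z then z else -star z
  have hf : ∀ z, 0 < z.re → (f z).re = z.re ∧ f z = z ∨ (f z).re < 0 ∧ f z = -star z := by
    intro z hz
    by_cases h1 : Z₁₁.charpoly.IsRoot z
    · have h2 : f z = z := if_pos h1
      exact Or.inl ⟨by rw [h2], h2⟩
    · have h2 : f z = -star z := if_neg h1
      exact Or.inr ⟨by rw [h2]; simpa using hz, h2⟩
  calc oddEigenvalueCount M ≤ (Z₁₁.charpoly.roots.toFinset : Set ℂ).ncard := by
        refine Set.ncard_le_ncard_of_injOn f ?_ ?_ (Finset.finite_toSet _)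
        · rintro z ⟨-, hz⟩
          simp only [Finset.mem_coe, Multiset.mem_toFinset]
          rw [Polynomial.mem_roots Z₁₁.charpoly_monic.ne_zero]
          by_cases h1 : Z₁₁.charpoly.IsRoot z
          · rwa [show f z = z from if_pos h1]
          · rw [show f z = -star z from if_neg h1]
            exact (hroot z hz).resolve_left h1
        · rintro z ⟨hz, -⟩ w ⟨hw, -⟩ hzw
          rcases hf z hz with ⟨h1, h2⟩ | ⟨h1, h2⟩ <;> rcases hf w hw with ⟨h3, h4⟩ | ⟨h3, h4⟩
          · rw [← h2, ← h4, hzw]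
          · rw [hzw] at h1; linarith
          · rw [hzw] at h1; linarith
          · rw [h2, h4] at hzw
            exact star_injective (neg_injective hzw)
    _ ≤ Z₁₁.charpoly.natDegree := by
        rw [Set.ncard_coe_finset]
        exact (Multiset.toFinset_card_le _).trans (Polynomial.card_roots' _)
    _ = Fintype.card m := Z₁₁.charpoly_natDegree_eq_dim

/-- The closed loop matrices `Z` and `Z + X K` agree modulo the range of `X`, and on this range they
are dual to each other. -/
lemma charpoly_add_mul_of_blockTriangular {Z X K : Matrix n n ℂ} {T : Matrix n (m ⊕ q) ℂ}
    {Y : Matrix m m ℂ} {Z₁₁ : Matrix m m ℂ} {Z₁₂ : Matrix m q ℂ} {Z₂₂ : Matrix q q ℂ}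
    (hT₁ : T * Tᴴ = 1) (hT₂ : Tᴴ * T = 1) (hY : IsUnit Y)
    (hX : X * T = T * (Matrix.fromBlocks Y 0 0 0 : Matrix (m ⊕ q) (m ⊕ q) ℂ))
    (hZ : Z * T = T * Matrix.fromBlocks Z₁₁ Z₁₂ 0 Z₂₂)
    (h : Z * X + X * Zᴴ + X * K * X = 0) :
    (Z + X * K).charpoly = (-Z₁₁ᴴ).charpoly * Z₂₂.charpoly := by
  have hd := (Matrix.isUnit_iff_isUnit_det _).1 hY
  set N : Matrix (m ⊕ q) (m ⊕ q) ℂ := Matrix.fromBlocks Y 0 0 0 with hN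
  set Kt := Tᴴ * K * T with hKt
  have hKT : K * T = T * Kt := by
    rw [hKt, ← Matrix.mul_assoc, ← Matrix.mul_assoc, hT₁, Matrix.one_mul]
  have hZH : Zᴴ * T = T * (Matrix.fromBlocks Z₁₁ Z₁₂ 0 Z₂₂)ᴴ := by
    have h1 : Zᴴ = T * (Matrix.fromBlocks Z₁₁ Z₁₂ 0 Z₂₂)ᴴ * Tᴴ := by
      have h2 : Z = T * Matrix.fromBlocks Z₁₁ Z₁₂ 0 Z₂₂ * Tᴴ := by
        rw [← hZ, Matrix.mul_assoc, hT₁, Matrix.mul_one]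
      conv_lhs => rw [h2]
      simp only [Matrix.conjTranspose_mul, Matrix.conjTranspose_conjTranspose, Matrix.mul_assoc]
    rw [h1, Matrix.mul_assoc, hT₂, Matrix.mul_one]
  have h11 : (Z₁₁ + Y * Kt.toBlocks₁₁) * Y = Y * -Z₁₁ᴴ := by
    have h1 : Tᴴ * ((Z * X + X * Zᴴ + X * K * X) * T) = 0 := by
      rw [h, Matrix.zero_mul, Matrix.mul_zero]
    have h2 : (Z * X + X * Zᴴ + X * K * X) * T = T *
        (Matrix.fromBlocks Z₁₁ Z₁₂ 0 Z₂₂ * N +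
        N * (Matrix.fromBlocks Z₁₁ Z₁₂ 0 Z₂₂)ᴴ +
        N * Kt * N) := by
      have e1 : Z * X * T = T * (Matrix.fromBlocks Z₁₁ Z₁₂ 0 Z₂₂ * N) := by
        rw [Matrix.mul_assoc, hX, ← Matrix.mul_assoc, hZ, Matrix.mul_assoc]
      have e2 : X * Zᴴ * T =
          T * (N * (Matrix.fromBlocks Z₁₁ Z₁₂ 0 Z₂₂)ᴴ) := by
        rw [Matrix.mul_assoc, hZH, ← Matrix.mul_assoc, hX, Matrix.mul_assoc]
      have e3 : X * K * X * T =
          T * (N * Kt * N) := by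
        rw [Matrix.mul_assoc, hX, ← Matrix.mul_assoc, Matrix.mul_assoc X, hKT, ← Matrix.mul_assoc X,
          hX]
        simp only [Matrix.mul_assoc]
      rw [Matrix.add_mul, Matrix.add_mul, e1, e2, e3, Matrix.mul_add, Matrix.mul_add]
    rw [h2, ← Matrix.mul_assoc, hT₂, Matrix.one_mul, hN, ← Matrix.fromBlocks_toBlocks Kt,
      Matrix.fromBlocks_conjTranspose, Matrix.fromBlocks_multiply, Matrix.fromBlocks_multiply,
      Matrix.fromBlocks_multiply, Matrix.fromBlocks_multiply, Matrix.fromBlocks_add,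
      Matrix.fromBlocks_add, ← Matrix.fromBlocks_zero, Matrix.fromBlocks_inj] at h1
    have h3 := h1.1
    simp only [Matrix.zero_mul, Matrix.mul_zero, add_zero] at h3
    rw [Matrix.add_mul, Matrix.mul_neg, eq_neg_iff_add_eq_zero, ← h3]
    abel
  rw [← charpoly_eq_of_mul_eq_mul (Matrix.mul_nonsing_inv _ hd) (Matrix.nonsing_inv_mul _ hd) h11,
    ← Matrix.charpoly_fromBlocks_zero₂₁ (M₁₂ := Z₁₂ + Y * Kt.toBlocks₁₂)]
  refine charpoly_eq_of_mul_eq_mul hT₁ hT₂ ?_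
  have h4 : Matrix.fromBlocks (Z₁₁ + Y * Kt.toBlocks₁₁) (Z₁₂ + Y * Kt.toBlocks₁₂) 0 Z₂₂ =
      Matrix.fromBlocks Z₁₁ Z₁₂ 0 Z₂₂ + N * Kt := by
    conv_rhs => rw [← Matrix.fromBlocks_toBlocks Kt]
    rw [hN, Matrix.fromBlocks_multiply, Matrix.fromBlocks_add]
    simp
  rw [h4, Matrix.add_mul, Matrix.mul_add, hZ, Matrix.mul_assoc, hKT, ← Matrix.mul_assoc, hX,
    Matrix.mul_assoc]

end Hamiltonian

/-! ### The minimal realization of the quotient -/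

section Quotient

variable {n ι : Type*} [Fintype n] [Fintype ι] [DecidableEq ι]

/-- The homogeneous Riccati equation for `X` says that `I - c (s I - Z)⁻¹ X cᴴ` is lossless with
respect to `X`. -/
lemma isLossless_of_lyapunov {Z X : Matrix n n ℂ} {c : Matrix ι n ℂ} (hX : X.IsHermitian)
    (h : Z * X + X * Zᴴ + X * (cᴴ * c) * X = 0) : IsLossless Z (-(X * cᴴ)) c 1 X where
  isHermitian := hX
  lyapunov := by
    rw [← h, Matrix.conjTranspose_neg, Matrix.conjTranspose_mul, Matrix.conjTranspose_conjTranspose,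
      hX.eq]
    simp only [Matrix.neg_mul, Matrix.mul_neg, neg_neg, Matrix.mul_assoc]
  cross := by simp
  unitary := by simp

/-- Restriction to the range of `X` turns the realization `(Z, -X cᴴ, c, I)` into a minimal one,
lossless with respect to an invertible diagonal matrix `Y` congruent to `X` on its range. The last
clause bounds the number of odd eigenvalues of a matrix whose characteristic polynomial is the
product of those of the closed loop matrices `Z + X cᴴ c` and `Z`. -/
lemma exists_minimal_lossless [DecidableEq n] {Z X : Matrix n n ℂ} {c : Matrix ι n ℂ} (hX : X.IsHermitian)
    (h : Z * X + X * Zᴴ + X * (cᴴ * c) * X = 0) (hc : IsObservable Z c) :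
    ∃ (m : Set n) (_ : Fintype m) (_ : DecidableEq m) (y : m → ℝ) (Z₁ : Matrix m m ℂ)
      (B₁ : Matrix m ι ℂ) (c₁ : Matrix ι m ℂ),
      transfer Z (-(X * cᴴ)) c 1 = transfer Z₁ B₁ c₁ 1 ∧
      IsLossless Z₁ B₁ c₁ 1 (Matrix.diagonal fun i => (y i : ℂ)) ∧ (∀ i, y i ≠ 0) ∧
      IsControllable Z₁ B₁ ∧ IsObservable Z₁ c₁ ∧ X.rank = Fintype.card m ∧
      ((Matrix.diagonal fun i => (y i : ℂ)).PosSemidef → X.PosSemidef) ∧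
      ∀ M : Matrix (n ⊕ n) (n ⊕ n) ℂ,
        M.charpoly = (Z + X * (cᴴ * c)).charpoly * Z.charpoly →
          oddEigenvalueCount M ≤ Fintype.card m := by
  obtain ⟨m, q, _, _, _, _, T, y, Z₁, Z₁₂, Z₂, hT₁, hT₂, hy, hXT, hZT, hrank⟩ :=
    exists_blockTriangular hX h
  set Y : Matrix m m ℂ := Matrix.diagonal fun i => (y i : ℂ) with hY
  have hYH : Yᴴ = Y := by
    rw [hY, Matrix.diagonal_conjTranspose]
    congr 1
    ext i
    simp
  have hYu : IsUnit Y := by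
    rw [Matrix.isUnit_iff_isUnit_det, hY, Matrix.det_diagonal, isUnit_iff_ne_zero,
      Finset.prod_ne_zero_iff]
    exact fun i _ => Complex.ofReal_ne_zero.2 (hy i)
  -- the columns of `U` span the range of `X`, those of `V` its kernel
  obtain ⟨U, V, rfl⟩ : ∃ (U : Matrix n m ℂ) (V : Matrix n q ℂ), T = Matrix.fromCols U V :=
    ⟨T.toCols₁, T.toCols₂, (Matrix.fromCols_toCols T).symm⟩
  have hZU : Z * U = U * Z₁ := by
    rw [Matrix.mul_fromCols, Matrix.fromCols_mul_fromBlocks] at hZT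
    have := congrArg Matrix.toCols₁ hZT
    simpa using this
  have hXU : X * U = U * Y ∧ X * V = 0 := by
    rw [Matrix.mul_fromCols, Matrix.fromCols_mul_fromBlocks] at hXT
    have h1 := congrArg Matrix.toCols₁ hXT
    have h2 := congrArg Matrix.toCols₂ hXT
    simp only [Matrix.toCols₁_fromCols, Matrix.toCols₂_fromCols, Matrix.mul_zero, add_zero]
      at h1 h2
    exact ⟨h1, h2⟩
  have hUU : Uᴴ * U = 1 := by
    rw [Matrix.conjTranspose_fromCols_eq_fromRows_conjTranspose, Matrix.fromRows_mul_fromCols,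
      ← Matrix.fromBlocks_one, Matrix.fromBlocks_inj] at hT₂
    exact hT₂.1
  have hXeq : X = U * Y * Uᴴ := by
    have h1 : X * (Matrix.fromCols U V * (Matrix.fromCols U V)ᴴ) = X := by
      rw [hT₁, Matrix.mul_one]
    rw [Matrix.conjTranspose_fromCols_eq_fromRows_conjTranspose, Matrix.fromCols_mul_fromRows,
      Matrix.mul_add, ← Matrix.mul_assoc, ← Matrix.mul_assoc, hXU.1, hXU.2, Matrix.zero_mul,
      add_zero] at h1
    exact h1.symm
  have hlyap : Z₁ * Y + Y * Z₁ᴴ + Y * ((c * U)ᴴ * (c * U)) * Y = 0 := by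
    have h1 : Uᴴ * (Z * X + X * Zᴴ + X * (cᴴ * c) * X) * U = 0 := by
      rw [h, Matrix.mul_zero, Matrix.zero_mul]
    have e1 : Uᴴ * (Z * X) * U = Z₁ * Y := by
      rw [Matrix.mul_assoc, Matrix.mul_assoc, hXU.1, ← Matrix.mul_assoc Z, hZU, ← Matrix.mul_assoc,
        ← Matrix.mul_assoc, hUU, Matrix.one_mul]
    have e2 : Uᴴ * (X * Zᴴ) * U = Y * Z₁ᴴ := by
      have := congrArg Matrix.conjTranspose e1
      simpa only [Matrix.conjTranspose_mul, Matrix.conjTranspose_conjTranspose, hX.eq, hYH,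
        Matrix.mul_assoc] using this
    have e3 : Uᴴ * X = Y * Uᴴ := by
      have := congrArg Matrix.conjTranspose hXU.1
      rwa [Matrix.conjTranspose_mul, Matrix.conjTranspose_mul, hX.eq, hYH] at this
    have e4 : Uᴴ * (X * (cᴴ * c) * X) * U = Y * ((c * U)ᴴ * (c * U)) * Y := by
      rw [Matrix.mul_assoc, Matrix.mul_assoc (X * _), hXU.1, Matrix.mul_assoc X,
        ← Matrix.mul_assoc Uᴴ, e3, Matrix.conjTranspose_mul]
      simp only [Matrix.mul_assoc]
    rw [Matrix.mul_add, Matrix.mul_add, Matrix.add_mul, Matrix.add_mul, e1, e2, e4] at h1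
    exact h1
  have hloss := isLossless_of_lyapunov hYH hlyap
  have hobs : IsObservable Z₁ (c * U) := hc.of_intertwine hZU hUU
  refine ⟨m, inferInstance, inferInstance, y, Z₁, -(Y * (c * U)ᴴ), c * U, ?_, hloss, hy,
    hloss.isControllable hYu hobs, hobs, hrank, fun hpos => ?_, fun M hM => ?_⟩
  · refine transfer_eq_of_intertwine hZU ?_ c 1
    rw [hXeq, Matrix.conjTranspose_mul]
    simp only [Matrix.mul_neg, Matrix.mul_assoc]
  · rw [hXeq]
    exact hpos.mul_mul_conjTranspose_same U
  · refine oddEigenvalueCount_le (Z₁₁ := Z₁) (Z₂₂ := Z₂) ?_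
    rw [hM, charpoly_add_mul_of_blockTriangular hT₁ hT₂ hYu hXT hZT h,
      charpoly_eq_of_mul_eq_mul hT₁ hT₂ hZT, Matrix.charpoly_fromBlocks_zero₂₁]
    ring

end Quotient

lemma posDef_fromBlocks {m n : Type*} [Fintype m] [DecidableEq m] [Fintype n] [DecidableEq n]
    {P : Matrix m m ℂ} {Y : Matrix n n ℂ} (hP : P.PosDef) (hY : Y.PosDef) :
    (Matrix.fromBlocks P 0 0 Y).PosDef := by
  have h1 : (Matrix.fromBlocks P 0 (0 : Matrix m n ℂ)ᴴ Y).PosSemidef := by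
    have := hP.isUnit.invertible
    rw [hP.fromBlocks₁₁]
    simpa using hY.posSemidef
  rw [Matrix.conjTranspose_zero] at h1
  exact h1.posDef_iff_isUnit.2 (Matrix.isUnit_fromBlocks_zero₂₁.2 ⟨hP.isUnit, hY.isUnit⟩)

end

end SymmetricDarlington

open SymmetricDarlington in
theorem proposition5p1 {p n : ℕ}
    (S : SymmetricDarlington.RatMatrix (Fin p) (Fin p))
    (hSchur : SymmetricDarlington.IsSchur S)
    (hSymm : Sᵀ = S)
    (hInf : SymmetricDarlington.StrictlyContractiveAtInfinity S)
    -- a minimal symmetric realization of `S`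
    (A : Matrix (Fin n) (Fin n) ℂ) (B : Matrix (Fin n) (Fin p) ℂ)
    (C : Matrix (Fin p) (Fin n) ℂ) (D : Matrix (Fin p) (Fin p) ℂ)
    (hReal : S = SymmetricDarlington.transfer A B C D)
    (hMin : SymmetricDarlington.mcMillanDegree S = n)
    (hA : Aᵀ = A) (hBC : Bᵀ = C) (hD : Dᵀ = D)
    -- a Hermitian solution of the Riccati equation
    (P : Matrix (Fin n) (Fin n) ℂ) (hP : P.IsHermitian)
    (hRic : SymmetricDarlington.riccati A B C D P = 0)
    -- the blocks of the extension, the function `Q`, and `Σ_P`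
    (S11 S12 S21 Q : SymmetricDarlington.RatMatrix (Fin p) (Fin p))
    (SigmaP : SymmetricDarlington.RatMatrix (Fin p ⊕ Fin p) (Fin p ⊕ Fin p))
    (hS11 : S11 = (SymmetricDarlington.extension A B C D P).toBlocks₁₁)
    (hS12 : S12 = (SymmetricDarlington.extension A B C D P).toBlocks₁₂)
    (hS21 : S21 = (SymmetricDarlington.extension A B C D P).toBlocks₂₁)
    (hQ : Q = S21⁻¹ * S12ᵀ)
    (hSigma : SigmaP =
      SymmetricDarlington.extension A B C D P * Matrix.fromBlocks Q 0 0 1) :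
    -- everything is well defined, and `Q` is unitary on the imaginary axis
    IsUnit P ∧ IsUnit S21 ∧ SymmetricDarlington.IsUnitaryOnAxis Q ∧
    -- `Σ_P` is a symmetric extension of `S`, unitary on the imaginary axis
    SigmaP = Matrix.fromBlocks (S11 * S21⁻¹ * S12ᵀ) S12 S12ᵀ S ∧
    SigmaPᵀ = SigmaP ∧
    SymmetricDarlington.IsUnitaryOnAxis SigmaP ∧
    -- degree of `Q`, and when `Q` is inner
    SymmetricDarlington.mcMillanDegree Q = ((P⁻¹ᵀ - P).rank : ℕ∞) ∧
    (SymmetricDarlington.IsInner Q ↔ (P⁻¹ᵀ - P).PosSemidef) ∧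
    (SymmetricDarlington.IsInner Q →
      SymmetricDarlington.IsInner SigmaP ∧
      SymmetricDarlington.mcMillanDegree SigmaP =
        SymmetricDarlington.mcMillanDegree S + SymmetricDarlington.mcMillanDegree Q) ∧
    -- the lower bound
    (SymmetricDarlington.oddEigenvalueCount (SymmetricDarlington.hamiltonian A B C D) : ℕ∞) ≤
      SymmetricDarlington.mcMillanDegree Q := by
  -- the value `D` at infinity is strictly contractive
  have hD1 : (1 - D * Dᴴ).PosDef := by
    obtain ⟨L, hL, hL1⟩ := hInf
    have : L = D := hL.unique (hReal ▸ hasValueAtInfinity_transfer A B C D)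
    rwa [this] at hL1
  -- minimality, and the spectrum of `A`
  have hctrl : IsControllable A B := isControllable_of_mcMillanDegree (hReal ▸ hMin)
  have hobs : IsObservable A C := by
    have := hctrl.isObservable_transpose
    rwa [hA, hBC] at this
  have hAspec : ∀ z : ℂ, 0 < z.re → IsUnit (Matrix.scalar (Fin n) z - A) := fun z hz =>
    isUnit_of_regularAt_transfer hctrl hobs (D := D) (hReal ▸ (hSchur z hz).1)
  -- the Riccati equation
  have hat := hatA_transpose hA hBC hD hD1
  have hKL := hatC_transpose hBC hD hD1
  have hu : IsUnit P := isUnit_of_riccati hP hRic (isControllable_hat hD1 hD hctrl)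
  set c := hatC C D with hc
  set a := hatA A B C D with ha
  have hRic' := riccati_inv_transpose hu hat hKL hRic
  have hlyap := riccati_sub hP (Matrix.isHermitian_conjTranspose_mul_self c) hRic hRic'
  set X := P⁻¹ᵀ - P with hXdef
  have hX : X.IsHermitian := hP.inv.transpose.sub hP
  -- the lossless extension
  have hE := isLossless_extension hD hD1 hP hu hRic
  have hAstable : IsStable A := isStable_of_lyapunov hE.lyapunov (hctrl.fromCols _) hAspec
  have hPpos : P.PosDef :=
    (hAstable.posSemidef_of_lyapunov hE.lyapunov).posDef_iff_isUnit.2 hu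
  have hblocks : extension A B C D P = Matrix.fromBlocks S11 S12 S21 S := by
    have h1 : (extension A B C D P).toBlocks₂₂ = S := by
      rw [extension, transfer_fromBlocks, Matrix.toBlocks_fromBlocks₂₂, hReal]
    rw [hS11, hS12, hS21, ← h1, Matrix.fromBlocks_toBlocks]
  have hS12' : S12 = transfer A B (C1 B C D P) (D12 D) := by
    rw [hS12, extension, transfer_fromBlocks, Matrix.toBlocks_fromBlocks₁₂]
  have hS21' : S21 = transfer A (B1 B C D P) C (D21 D) := by
    rw [hS21, extension, transfer_fromBlocks, Matrix.toBlocks_fromBlocks₂₁]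
  have hS21u : IsUnit S21 := hS21' ▸ isUnit_transfer _ _ _ (isUnit_D21 hD1)
  have hS12u : IsUnit S12 := hS12' ▸ isUnit_transfer _ _ _ (isUnit_D12 hD hD1)
  -- the quotient `Q` and its minimal realization
  have hQ1 : Q = transfer (a + P * (cᴴ * c)) (-(X * cᴴ)) c 1 := by
    rw [hQ, hS12', hS21', quotient_eq_transfer hA hBC hD hD1]
  have hQloss := isLossless_of_lyapunov hX hlyap
  have hZobs : IsObservable (a + P * (cᴴ * c)) c := by
    have h1 := (hobs.add_mul (B * Dᴴ * (1 - D * Dᴴ)⁻¹ + P * cᴴ * (D21 D)⁻¹)).isUnit_mul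
      (Matrix.isUnit_nonsing_inv_iff.2 (isUnit_D21 hD1))
    rw [Matrix.add_mul, ← add_assoc, Matrix.mul_assoc (P * cᴴ), Matrix.mul_assoc P] at h1
    exact h1
  obtain ⟨m, _, _, y, Z₁, B₁, c₁, hQ2, hQloss₁, hy, hctrl₁, hobs₁, hrank, hpos, hodd⟩ :=
    exists_minimal_lossless hX hlyap hZobs
  have hQ3 := hQ1.trans hQ2
  have hQdeg : mcMillanDegree Q = (X.rank : ℕ∞) := by
    rw [hQ3, mcMillanDegree_transfer hctrl₁ hobs₁, hrank]
  have hQstable : IsInner Q → IsStable Z₁ := fun hin =>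
    isStable_of_lyapunov hQloss₁.lyapunov hctrl₁ fun z hz =>
      isUnit_of_regularAt_transfer hctrl₁ hobs₁ (D := 1) (hQ3 ▸ (hin.1 z hz).1)
  -- the symmetric extension
  have hSigma1 : SigmaP = Matrix.fromBlocks (S11 * S21⁻¹ * S12ᵀ) S12 S12ᵀ S := by
    rw [hSigma, hblocks, Matrix.fromBlocks_multiply, hQ, ← Matrix.mul_assoc S21,
      Matrix.mul_nonsing_inv _ ((Matrix.isUnit_iff_isUnit_det _).1 hS21u)]
    simp only [Matrix.mul_zero, Matrix.mul_one, Matrix.one_mul, add_zero, zero_add,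
      Matrix.mul_assoc]
  have hSloss := hE.series (hQloss₁.fromBlocks_one (ι' := Fin p))
  have hSigma2 := hSigma
  rw [hQ3, ← transfer_fromBlocks_one, extension, transfer_mul_transfer] at hSigma2
  have hSunit : IsUnitaryOnAxis SigmaP := hSigma2 ▸ hSloss.isUnitaryOnAxis
  have hSsymm : SigmaPᵀ = SigmaP := by
    have h1 := transpose_eq_of_isUnitaryOnAxis hSymm hS12u (hSigma1 ▸ hSunit)
    rw [hSigma1, Matrix.fromBlocks_transpose, h1, Matrix.transpose_transpose, hSymm]
  refine ⟨hu, hS21u, hQ1 ▸ hQloss.isUnitaryOnAxis, hSigma1, hSsymm, hSunit, hQdeg,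
    ⟨fun hin => ?_, fun hpsd => hQ1 ▸ hQloss.isInner hpsd⟩, fun hin => ?_, ?_⟩
  · exact hpos ((hQstable hin).posSemidef_of_lyapunov hQloss₁.lyapunov)
  · have hYpos : (Matrix.diagonal fun i => (y i : ℂ)).PosDef := by
      refine ((hQstable hin).posSemidef_of_lyapunov hQloss₁.lyapunov).posDef_iff_isUnit.2 ?_
      rw [Matrix.isUnit_iff_isUnit_det, Matrix.det_diagonal, isUnit_iff_ne_zero,
        Finset.prod_ne_zero_iff]
      exact fun i _ => Complex.ofReal_ne_zero.2 (hy i)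
    have hGpos : (Matrix.fromBlocks P 0 0 (Matrix.diagonal fun i => (y i : ℂ))).PosDef := posDef_fromBlocks hPpos hYpos
    obtain ⟨h1, h2⟩ := hSloss.isControllable_and_isObservable
      (isStable_fromBlocks hAstable (hQstable hin) _) hGpos
    refine ⟨hSigma2 ▸ hSloss.isInner hGpos.posSemidef, ?_⟩
    rw [hMin, hQdeg, hSigma2, mcMillanDegree_transfer h1 h2, hrank, Fintype.card_sum,
      Fintype.card_fin, Nat.cast_add]
  · rw [hQdeg, hrank, Nat.cast_le]
    refine hodd _ ?_
    rw [hamiltonian, charpoly_fromBlocks_of_riccati hRic,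
      charpoly_neg_conjTranspose_of_riccati hu hat hKL hRic]
    congr 2
    rw [hXdef, Matrix.sub_mul]
    abel
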